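/- Let $T$ be a $k$-regular tree ($k\ge 2$), $\mathcal A$ a countable set and $\phi: VT\to\mathcal A$ a coloring of its vertices. Write $B_n(x)$ for the $n$-ball around a vertex $x$ and $[B_n(x)]$ for its class under color-preserving graph isomorphism of balls. Let $b(n)$ be the number of classes $[B_n(x)]$, $x\in VT$. Suppose that $\phi$ is Sturmian, i.e. $b(n)=n+2$ for all $n\ge 0$. A class $[B_n(x)]$ is special if there are $y,z$ with $[B_n(y)]=[B_n(z)]=[B_n(x)]$ and $[B_{n+1}(y)]\ne[B_{n+1}(z)]$. The coloring is of bounded type if for some vertex $x$ only finitely many of the classes $[B_n(x)]$, $n\ge0$, are special. A coloring is periodic if it is invariant under some group $\Gamma'$ of automorphisms of $T$ with $\Gamma'\backslash T$ a finite graph. It is eventually periodic if there is a finite subtree $K$ such that on each connected component of $T-K$ it agrees with some periodic coloring of $T$. Let $\Gamma$ be the group of all color-preserving automorphisms of $T$ and $X=\Gamma\backslash T$ the quotient graph, whose vertices and oriented edges are the $\Gamma$-orbits of vertices and oriented edges of $T$. (An edge of $T$ inverted by an element of $\Gamma$ gives a half-edge of $X$, regarded as a loop.) The index of an oriented edge of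 $X$ is the number of its lifts starting at a given lift of its initial vertex. Then the following hold. (1) $\phi$ is $\Gamma$-invariant, hence the lift of a coloring $\phi_X$ of the vertices of $X$. Moreover $X$ is either a geodesic ray (vertices $0,1,2,\dots$) or a bi-infinite geodesic (vertices indexed by $\mathbb Z$), with exactly one edge between consecutive vertices, and at each vertex possibly one loop, which is a half-edge, and no other edges. (2) If $\phi$ is of bounded type, then $X$ is a geodesic ray, possibly with loops as in (1). (3) Consider the following two edge-indexed rays with vertices $0,1,2,\dots$. (a) There is a half-edge loop of index $1$ at $0$ and no other loop; every edge $[n,n+1]$ has index $k-1$ and every edge $[n+1,n]$ has index $1$. (b) There are no loops; the edge $[0,1]$ has index $k$, the edges $[n,n+1]$ with $n\ge1$ have index $k-1$, and every edge $[n+1,n]$ has index $1$. If $\phi$ is eventually periodic, then $X$ is isomorphic to (a) or (b) as an edge-indexed graph. Conversely, if $X$ is isomorphic to (a) or (b), and if $k\ge3$ or $\phi$ is of bounded type, then $\phi$ is eventually periodic. -/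

import Mathlib

namespace TreeColoring

universe u v w

/-! ### Graphs with oriented edges, possibly with loops and half-edges -/

/-- A graph in the sense of Serre: a set of vertices, a set of oriented edges, the initial vertex
of an oriented edge, and the reversal of orientation. An oriented edge may be its own reverse;
such a half-edge (a quotient of an inverted edge) is a loop at its initial vertex. -/
structure OrientedGraph : Type (u + 1) where
  /-- vertices -/
  Vert : Type u
  /-- oriented edges -/
  Edge : Type u
  /-- initial vertex -/
  src : Edge → Vert
  /-- reversed edge -/
  rev : Edge → Edge
  rev_rev : ∀ e, rev (rev e) = e

/-- An isomorphism of graphs (it then respects terminal vertices `src (rev e)` as well). -/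
structure OrientedGraph.Iso (X : OrientedGraph.{u}) (Y : OrientedGraph.{v}) where
  /-- the bijection on vertices -/
  vert : X.Vert ≃ Y.Vert
  /-- the bijection on oriented edges -/
  edge : X.Edge ≃ Y.Edge
  src_edge : ∀ e, Y.src (edge e) = vert (X.src e)
  rev_edge : ∀ e, Y.rev (edge e) = edge (X.rev e)

/-- An edge-indexed graph: every oriented edge carries a natural number. -/
structure EdgeIndexedGraph : Type (u + 1) extends OrientedGraph.{u} where
  /-- the index of an oriented edge -/
  index : Edge → ℕ

/-- Two edge-indexed graphs are isomorphic: there is a graph isomorphism preserving indices. -/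
def EdgeIndexedGraph.Isomorphic (X : EdgeIndexedGraph.{u}) (Y : EdgeIndexedGraph.{v}) : Prop :=
  ∃ f : X.toOrientedGraph.Iso Y.toOrientedGraph, ∀ e, Y.index (f.edge e) = X.index e

/-- The simple graph `G` with one loop (a half-edge) attached at each vertex of `S`. -/
def withLoops {ι : Type u} (G : SimpleGraph ι) (S : Set ι) : OrientedGraph.{u} where
  Vert := ι
  Edge := G.Dart ⊕ S
  src := Sum.elim (fun d => d.fst) (fun s => s.1)
  rev := Sum.map (fun d => d.symm) id
  rev_rev := by rintro (d | s) <;> simp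

/-- `X` is a geodesic ray with loops possibly attached. (`SimpleGraph.hasse ℕ` is the graph
on `ℕ` in which the neighbours are the pairs `n`, `n + 1`.) -/
def OrientedGraph.IsRayWithLoops (X : OrientedGraph.{u}) : Prop :=
  ∃ S : Set ℕ, Nonempty (X.Iso (withLoops (SimpleGraph.hasse ℕ) S))

/-- `X` is a bi-infinite geodesic with loops possibly attached. -/
def OrientedGraph.IsLineWithLoops (X : OrientedGraph.{u}) : Prop :=
  ∃ S : Set ℤ, Nonempty (X.Iso (withLoops (SimpleGraph.hasse ℤ) S))

/-- The ray `0, 1, 2, …` with a half-edge at `0` of index `1`; every edge `[n, n+1]` has index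
`k - 1` and every edge `[n+1, n]` has index `1`. -/
def halfEdgeRay (k : ℕ) : EdgeIndexedGraph.{0} where
  toOrientedGraph := withLoops (SimpleGraph.hasse ℕ) {0}
  index := Sum.elim (fun d => if d.fst < d.snd then k - 1 else 1) (fun _ => 1)

/-- The ray `0, 1, 2, …` without loops; the edge `[0, 1]` has index `k`, the edges `[n, n+1]`
with `n ≥ 1` have index `k - 1` and every edge `[n+1, n]` has index `1`. -/
def plainRay (k : ℕ) : EdgeIndexedGraph.{0} where
  toOrientedGraph := withLoops (SimpleGraph.hasse ℕ) ∅
  index := Sum.elim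
    (fun d => if d.fst < d.snd then (if d.fst = 0 then k else k - 1) else 1) (fun _ => 1)

/-! ### Quotients of a graph by a group of automorphisms -/

section Quotient

variable {V : Type u} (T : SimpleGraph V) (Γ : Subgroup (T ≃g T))

/-- Two vertices are equivalent if they lie in the same `Γ`-orbit. -/
def vertSetoid : Setoid V where
  r x y := ∃ γ ∈ Γ, γ x = y
  iseqv :=
    { refl := fun _ => ⟨1, Γ.one_mem, rfl⟩
      symm := by
        rintro _ _ ⟨γ, hγ, rfl⟩
        exact ⟨γ⁻¹, Γ.inv_mem hγ, RelIso.symm_apply_apply γ _⟩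
      trans := by
        rintro _ _ _ ⟨γ, hγ, rfl⟩ ⟨δ, hδ, rfl⟩
        exact ⟨δ * γ, Γ.mul_mem hδ hγ, rfl⟩ }

/-- Two oriented edges are equivalent if they lie in the same `Γ`-orbit. -/
def edgeSetoid : Setoid T.Dart where
  r d e := ∃ γ ∈ Γ, γ d.fst = e.fst ∧ γ d.snd = e.snd
  iseqv :=
    { refl := fun _ => ⟨1, Γ.one_mem, rfl, rfl⟩
      symm := by
        rintro _ _ ⟨γ, hγ, h₁, h₂⟩
        refine ⟨γ⁻¹, Γ.inv_mem hγ, ?_, ?_⟩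
        · rw [← h₁]; exact RelIso.symm_apply_apply γ _
        · rw [← h₂]; exact RelIso.symm_apply_apply γ _
      trans := by
        rintro _ _ _ ⟨γ, hγ, h₁, h₂⟩ ⟨δ, hδ, h₃, h₄⟩
        refine ⟨δ * γ, Γ.mul_mem hδ hγ, ?_, ?_⟩
        · rw [← h₃, ← h₁]; rfl
        · rw [← h₄, ← h₂]; rfl }

/-- The number of oriented edges with the same initial vertex as `d` and in its `Γ`-orbit. -/
noncomputable def edgeCount (d : T.Dart) : ℕ :=
  Nat.card {e : T.Dart // e.fst = d.fst ∧ (edgeSetoid T Γ).r d e}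

theorem edgeCount_congr {d d' : T.Dart} (h : (edgeSetoid T Γ).r d d') :
    edgeCount T Γ d = edgeCount T Γ d' := by
  obtain ⟨γ, hγ, h₁, h₂⟩ := id h
  refine Nat.card_congr
    { toFun := fun e => ⟨⟨(γ e.1.fst, γ e.1.snd), γ.map_adj_iff.2 e.1.adj⟩, ?_, ?_⟩
      invFun := fun e =>
        ⟨⟨(γ.symm e.1.fst, γ.symm e.1.snd), γ.symm.map_adj_iff.2 e.1.adj⟩, ?_, ?_⟩
      left_inv := ?_
      right_inv := ?_ }
  · show γ e.1.fst = d'.fst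
    rw [e.2.1, h₁]
  · exact (edgeSetoid T Γ).trans' ((edgeSetoid T Γ).symm' h)
      ((edgeSetoid T Γ).trans' e.2.2 ⟨γ, hγ, rfl, rfl⟩)
  · show γ.symm e.1.fst = d.fst
    rw [e.2.1, ← h₁, RelIso.symm_apply_apply]
  · exact (edgeSetoid T Γ).trans' h
      ((edgeSetoid T Γ).trans' e.2.2 ⟨γ⁻¹, Γ.inv_mem hγ, rfl, rfl⟩)
  · rintro ⟨⟨⟨a, b⟩, hab⟩, he⟩
    simp
  · rintro ⟨⟨⟨a, b⟩, hab⟩, he⟩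
    simp

/-- The quotient graph `Γ \ T`, with vertices and oriented edges the `Γ`-orbits of vertices and
oriented edges of `T`. The index of an oriented edge is the number of its lifts to `T` that start
at a given lift of its initial vertex. -/
noncomputable def quotientGraph : EdgeIndexedGraph.{u} where
  Vert := Quotient (vertSetoid T Γ)
  Edge := Quotient (edgeSetoid T Γ)
  src := Quotient.map (fun d => d.fst) (fun _ _ ⟨γ, hγ, h₁, _⟩ => ⟨γ, hγ, h₁⟩)
  rev := Quotient.map (fun d => d.symm) (fun _ _ ⟨γ, hγ, h₁, h₂⟩ => ⟨γ, hγ, h₂, h₁⟩)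
  rev_rev := by
    rintro ⟨d⟩
    exact congrArg (Quotient.mk (edgeSetoid T Γ)) d.symm_symm
  index := Quotient.lift (edgeCount T Γ) (fun _ _ h => edgeCount_congr T Γ h)

/-- The projection from the vertices of `T` to those of `Γ \ T`. -/
def quotientProj (x : V) : (quotientGraph T Γ).Vert := Quotient.mk (vertSetoid T Γ) x

end Quotient

/-! ### Colorings, subword complexity, types -/

section Coloring

variable {V : Type u} {A : Type v} (T : SimpleGraph V) (φ : V → A)

/-- The vertices of the `n`-ball around `x` (for a connected graph `T`). -/
def ball (n : ℕ) (x : V) : Set V := {y | T.dist x y ≤ n}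

/-- The `n`-balls around `x` and `y` are isomorphic by a color-preserving graph isomorphism. -/
def ballSetoid (n : ℕ) : Setoid V where
  r x y := ∃ f : T.induce (ball T n x) ≃g T.induce (ball T n y),
    ∀ z : ball T n x, φ (f z : V) = φ z
  iseqv :=
    { refl := fun _ => ⟨SimpleGraph.Iso.refl, fun _ => rfl⟩
      symm := by
        rintro _ _ ⟨f, hf⟩
        exact ⟨f.symm, fun z => by rw [← hf (f.symm z), RelIso.apply_symm_apply]⟩
      trans := by
        rintro _ _ _ ⟨f, hf⟩ ⟨g, hg⟩
        exact ⟨f.trans g, fun z => (hg (f z)).trans (hf z)⟩ }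

/-- The class `[B_n(x)]` of the colored `n`-ball around `x`. -/
def ballClass (n : ℕ) (x : V) : Quotient (ballSetoid T φ n) := Quotient.mk _ x

/-- The subword complexity `b(n)`, the number of colored `n`-balls (every class is that of a ball
around some vertex; the value is `0` if there are infinitely many). -/
noncomputable def subwordComplexity (n : ℕ) : ℕ := Nat.card (Quotient (ballSetoid T φ n))

/-- A coloring is Sturmian if `b(n) = n + 2` for all `n`. -/
def IsSturmian : Prop := ∀ n, subwordComplexity T φ n = n + 2

/-- A colored `n`-ball is special if it has two distinct extensions to colored `(n+1)`-balls. -/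
def IsSpecial (n : ℕ) (B : Quotient (ballSetoid T φ n)) : Prop :=
  ∃ x y : V, ballClass T φ n x = B ∧ ballClass T φ n y = B ∧
    ballClass T φ (n + 1) x ≠ ballClass T φ (n + 1) y

/-- The type set of a vertex. -/
def typeSet (x : V) : Set ℕ := {n | IsSpecial T φ n (ballClass T φ n x)}

/-- A coloring is of bounded type if some vertex has a finite type set. -/
def IsBoundedType : Prop := ∃ x, (typeSet T φ x).Finite

/-- The group of color-preserving automorphisms of `T`. -/
def colorAut : Subgroup (T ≃g T) where
  carrier := {γ | ∀ x, φ (γ x) = φ x}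
  one_mem' := fun _ => rfl
  mul_mem' := fun {γ δ} hγ hδ x => (hγ (δ x)).trans (hδ x)
  inv_mem' := fun {γ} hγ x => by
    rw [← hγ (γ⁻¹ x)]
    exact congrArg φ (RelIso.apply_symm_apply γ x)

/-- A coloring is periodic if it is invariant under a group of automorphisms of `T` with finite
quotient graph. -/
def IsPeriodic : Prop :=
  ∃ Γ : Subgroup (T ≃g T), Finite (quotientGraph T Γ).Vert ∧ Finite (quotientGraph T Γ).Edge ∧
    ∀ γ ∈ Γ, ∀ x, φ (γ x) = φ x

/-- A coloring is eventually periodic if there is a finite subtree `K` such that, on each of the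
connected components of `T - K`, it agrees with a periodic coloring of `T`. -/
def IsEventuallyPeriodic : Prop :=
  ∃ K : Set V, K.Finite ∧ (T.induce K).Connected ∧
    ∀ C : (T.induce Kᶜ).ConnectedComponent, ∃ ψ : V → A, IsPeriodic T ψ ∧
      ∀ x ∈ C.supp, ψ x = φ x

end Coloring

end TreeColoring

open TreeColoring

/-!
The `n`-ball classes of a Sturmian coloring form a sequence of finer and finer equivalence relations
on the vertices. An isomorphism of `(n+1)`-balls preserves centers and thus matches the `n`-ball
classes of the neighbours, and since there are `n + 2` classes at level `n`, at each level exactly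
one class, the special one, splits, and it splits into two. This is recorded in
`IsSturmianRefinement`; the structure of the quotient graph follows from it alone. Vertices
which are equivalent at every level have neighbours matching at every level
(`IsSturmianRefinement.matched_limit`). In a tree such local matchings can be glued to an automorphism
(`exists_iso_of_matched`), so the vertices of the quotient graph are the limit classes, and an edge
is determined by its endpoints.

If the class of `x` is special infinitely often, then `x` has at most two neighbours up to
equivalence, apart from those equivalent to itself (`card_neighbor_types_le_two`): whenever the class
of `x` splits, at a level at which the classes distinguish all vertices near `x` that are not
equivalent, the class of each of these neighbours splits one level before or one level later, and
only one class can do so at either level. An infinite connected graph in which no vertex has three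
neighbours is a ray or a line (`nonempty_iso_hasse`).

Bounded type means that some class contains only finitely many limit classes. The special class
contains infinitely many, as otherwise, by connectedness, the quotient graph would be finite
(`not_hasFewTypes_of_splits`). Hence classes with few types are never special, each of
their neighbours has few types as well or is special, and at each level exactly one limit class is
separated from the special class and added to them. So the quotient graph is a ray
(`exists_ray_labelling`).

If the coloring is eventually periodic, then the number of classes of balls far away from the
exceptional subtree is bounded, so that some class is finite (`exists_finite_cell`). Then the
coloring has bounded type, all orbits are finite, and the indices are found by looking at a vertex of
degree at most one in the finite forest of all vertices with label at most `n`
(`isRadial_of_finite_fibers`). Conversely, if the quotient graph has these indices, then the color of a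
vertex depends on the distance to a vertex or an edge. The sequence of colors is
eventually periodic: for degree at least three because it has at most three factors of length
three (`exists_eventual_period_of_card_le_three`), for bounded type because, from some point on, the
classes at a suitable level of two consecutive vertices determine the next one. A
radial coloring with such a sequence agrees on cones with a coloring by a Busemann function modulo
the period (`IsRadial.isEventuallyPeriodic`), which is periodic.
-/

namespace TreeColoring

universe u v w

/-! ### Distances and automorphisms of trees -/

section Tree

variable {V : Type u} {T : SimpleGraph V}

theorem exists_adj_dist_eq_add_one (hT : T.Connected) {r x : V} (h : x ≠ r) :
    ∃ y, T.Adj x y ∧ T.dist r x = T.dist r y + 1 := by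
  obtain ⟨p, hp⟩ := hT.exists_walk_length_eq_dist x r
  cases p with
  | nil => exact absurd rfl h
  | cons hxy q =>
    rename_i y
    refine ⟨y, hxy, ?_⟩
    have h1 := T.dist_le q
    rw [SimpleGraph.Walk.length_cons] at hp
    have h2 := hxy.diff_dist_adj (u := r)
    rw [T.dist_comm (u := x), T.dist_comm (u := y)] at *
    omega

theorem eq_of_adj_of_dist (hT : T.IsTree) {r x y z : V} (hy : T.Adj x y) (hz : T.Adj x z)
    (hdy : T.dist r x = T.dist r y + 1) (hdz : T.dist r x = T.dist r z + 1) : y = z := by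
  obtain ⟨p, hp⟩ := hT.connected.exists_walk_length_eq_dist r y
  obtain ⟨q, hq⟩ := hT.connected.exists_walk_length_eq_dist r z
  have hp' := (p.concat hy.symm).isPath_of_length_eq_dist (by simp [hp, hdy])
  have hq' := (q.concat hz.symm).isPath_of_length_eq_dist (by simp [hq, hdz])
  have h := (hT.existsUnique_path r x).unique hp' hq'
  have := congrArg SimpleGraph.Walk.penultimate h
  simpa using this

/-- In a tree only one neighbour of `x` is closer to `r`; every other one is farther away. -/
theorem dist_eq_add_one_of_ne (hT : T.IsTree) {r x y z : V} (hy : T.Adj x y) (hz : T.Adj x z)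
    (hdy : T.dist r x = T.dist r y + 1) (hne : z ≠ y) : T.dist r z = T.dist r x + 1 := by
  rcases hT.dist_eq_dist_add_one_of_adj r hz with h | h
  · exact absurd (eq_of_adj_of_dist hT hz hy h hdy) hne
  · exact h

theorem exists_adj_ne [T.LocallyFinite] {k : ℕ} (hk : T.IsRegularOfDegree k) (h2 : 2 ≤ k)
    (x y : V) : ∃ z, T.Adj x z ∧ z ≠ y := by
  have h : 1 < (T.neighborFinset x).card := by
    rw [T.card_neighborFinset_eq_degree, hk x]; omega
  obtain ⟨z, hz, hne⟩ := Finset.exists_mem_ne h y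
  exact ⟨z, by simpa using hz, hne⟩

theorem exists_adj_farther [T.LocallyFinite] (hT : T.IsTree) {k : ℕ}
    (hk : T.IsRegularOfDegree k) (h2 : 2 ≤ k) (r x : V) :
    ∃ z, T.Adj x z ∧ T.dist r z = T.dist r x + 1 := by
  by_cases hx : x = r
  · subst hx
    obtain ⟨z, hz, -⟩ := exists_adj_ne hk h2 x x
    exact ⟨z, hz, by simp [SimpleGraph.dist_eq_one_iff_adj.2 hz]⟩
  · obtain ⟨y, hy, hd⟩ := exists_adj_dist_eq_add_one hT.connected hx
    obtain ⟨z, hz, hne⟩ := exists_adj_ne hk h2 x y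
    exact ⟨z, hz, dist_eq_add_one_of_ne hT hy hz hd hne⟩

theorem dist_le_add_one (hT : T.Connected) (r : V) {x y : V} (h : T.Adj x y) :
    T.dist r y ≤ T.dist r x + 1 := by
  have := hT.dist_triangle (u := r) (v := x) (w := y)
  rwa [SimpleGraph.dist_eq_one_iff_adj.2 h] at this

/-- Geodesics in a regular tree of degree at least two can be prolonged. -/
theorem exists_dist_eq_add [T.LocallyFinite] (hT : T.IsTree) {k : ℕ}
    (hk : T.IsRegularOfDegree k) (h2 : 2 ≤ k) (r x : V) (n : ℕ) :
    ∃ z, T.dist x z = n ∧ T.dist r z = T.dist r x + n := by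
  induction n with
  | zero => exact ⟨x, by simp, by simp⟩
  | succ n ih =>
    obtain ⟨w, hw, hrw⟩ := ih
    obtain ⟨z, hz, hd⟩ := exists_adj_farther hT hk h2 r w
    have h1 := dist_le_add_one hT.connected x hz
    have h3 := hT.connected.dist_triangle (u := r) (v := x) (w := z)
    exact ⟨z, by omega, by omega⟩

theorem finite_ball [T.LocallyFinite] (hT : T.Connected) (n : ℕ) (x : V) :
    (ball T n x).Finite := by
  induction n with
  | zero =>
    refine (Set.finite_singleton x).subset fun y hy => ?_
    have : T.dist x y = 0 := Nat.le_zero.1 hy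
    exact ((hT.dist_eq_zero_iff).1 this).symm
  | succ n ih =>
    refine (ih.union (ih.biUnion fun y _ => (T.neighborSet y).toFinite)).subset fun z hz => ?_
    by_cases hzx : z = x
    · left; subst hzx; simp [ball]
    · obtain ⟨y, hy, hd⟩ := exists_adj_dist_eq_add_one hT hzx
      right
      have hz' : T.dist x z ≤ n + 1 := hz
      have hy' : y ∈ ball T n x := show T.dist x y ≤ n by omega
      exact Set.mem_biUnion hy' hy.symm

/-- A finite nonempty set of vertices of a tree has an element with at most one neighbour in
it, namely one farthest from a base point. -/
theorem exists_adj_mem_subsingleton (hT : T.IsTree) {W : Set V} (hW : W.Finite)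
    (hne : W.Nonempty) :
    ∃ w ∈ W, ∀ y ∈ W, ∀ z ∈ W, T.Adj w y → T.Adj w z → y = z := by
  obtain ⟨r⟩ := hT.connected.nonempty
  obtain ⟨w, hw, hmax⟩ := Set.exists_max_image W (T.dist r) hW hne
  refine ⟨w, hw, fun y hy z hz hwy hwz => eq_of_adj_of_dist (r := r) hT hwy hwz ?_ ?_⟩
  · rcases hT.dist_eq_dist_add_one_of_adj r hwy with h | h
    · exact h
    · have := hmax y hy; omega
  · rcases hT.dist_eq_dist_add_one_of_adj r hwz with h | h
    · exact h
    · have := hmax z hz; omega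

/-- Induction along a walk: a set of vertices of a connected graph which is closed under passing
to neighbours and is not empty contains every vertex. -/
theorem forall_of_adj_closed (hT : T.Connected) {P : V → Prop} {x : V} (hx : P x)
    (hP : ∀ y z, T.Adj y z → P y → P z) (y : V) : P y := by
  obtain ⟨p⟩ := hT.preconnected x y
  induction p with
  | nil => exact hx
  | cons h q ih => exact ih (hP _ _ h hx)

theorem exists_adj_boundary (hT : T.Connected) {P : V → Prop} {x y : V} (hx : P x) (hy : ¬ P y) :
    ∃ a b, T.Adj a b ∧ P a ∧ ¬ P b := by
  by_contra! h
  exact hy (forall_of_adj_closed hT hx h y)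

end Tree

/-! ### Maps which are bijective on neighbours -/

section LocalIso

variable {V : Type u} {T : SimpleGraph V}

/-- A self-map of a tree that is injective on the neighbours of every vertex preserves distances:
a path without backtracking is mapped to a path without backtracking. -/
theorem dist_map_of_injOn (hT : T.IsTree) {f : V → V}
    (hf : ∀ x, Set.MapsTo f (T.neighborSet x) (T.neighborSet (f x)))
    (hi : ∀ x, Set.InjOn f (T.neighborSet x)) (r x : V) :
    T.dist (f r) (f x) = T.dist r x := by
  induction hn : T.dist r x using Nat.strong_induction_on generalizing x with
  | _ n ih =>
    subst hn
    by_cases hx : x = r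
    · subst hx; simp
    obtain ⟨p, hp, hdp⟩ := exists_adj_dist_eq_add_one hT.connected hx
    have ihp := ih _ (by omega) p rfl
    have hfpx : T.Adj (f p) (f x) := hf p hp.symm
    by_cases hpr : p = r
    · subst hpr
      rw [SimpleGraph.dist_eq_one_iff_adj.2 hfpx, SimpleGraph.dist_eq_one_iff_adj.2 hp.symm]
    obtain ⟨q, hq, hdq⟩ := exists_adj_dist_eq_add_one hT.connected hpr
    have ihq := ih _ (by omega) q rfl
    have hne : f x ≠ f q := fun h => by
      have := hi p hp.symm hq h
      subst this; omega
    rw [dist_eq_add_one_of_ne hT (hf p hq) hfpx (by omega) hne, ihp, hdp]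

theorem exists_iso_of_bijOn (hT : T.IsTree) {f : V → V}
    (hf : ∀ x, Set.BijOn f (T.neighborSet x) (T.neighborSet (f x))) :
    ∃ γ : T ≃g T, ∀ x, γ x = f x := by
  have hd := dist_map_of_injOn hT (fun x => (hf x).mapsTo) (fun x => (hf x).injOn)
  have hinj : Function.Injective f := fun a b hab => by
    have := hd a b
    rw [hab, T.dist_self] at this
    exact (hT.connected.dist_eq_zero_iff).1 this.symm
  have hsurj : Function.Surjective f := by
    obtain ⟨r⟩ := hT.connected.nonempty
    refine forall_of_adj_closed hT.connected (P := fun y => ∃ x, f x = y) ⟨r, rfl⟩ ?_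
    rintro _ z hz ⟨x, rfl⟩
    obtain ⟨w, -, hw⟩ := (hf x).surjOn hz
    exact ⟨w, hw⟩
  refine ⟨⟨Equiv.ofBijective f ⟨hinj, hsurj⟩, ?_⟩, fun _ => rfl⟩
  intro a b
  rw [← SimpleGraph.dist_eq_one_iff_adj, ← SimpleGraph.dist_eq_one_iff_adj]
  exact (hd a b).symm ▸ Iff.rfl

/-- The neighbours of `x` and of `y` correspond to each other up to the equivalence relation
`r`. -/
def Matched (T : SimpleGraph V) (r : Setoid V) (x y : V) : Prop :=
  ∃ σ : T.neighborSet x ≃ T.neighborSet y, ∀ z : T.neighborSet x, r (z : V) (σ z)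

theorem Matched.exists_adj {r : Setoid V} {x y z : V} (h : Matched T r x y) (hz : T.Adj x z) :
    ∃ w, T.Adj y w ∧ r z w := by
  obtain ⟨σ, hσ⟩ := h
  exact ⟨σ ⟨z, hz⟩, (σ ⟨z, hz⟩).2, hσ ⟨z, hz⟩⟩

theorem Matched.symm {r : Setoid V} {x y : V} (h : Matched T r x y) : Matched T r y x := by
  obtain ⟨σ, hσ⟩ := h
  refine ⟨σ.symm, fun z => ?_⟩
  have := hσ (σ.symm z)
  rw [Equiv.apply_symm_apply] at this
  exact r.symm' this

/-- A correspondence of neighbours can be modified so that it maps a given neighbour to a given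
equivalent one. -/
theorem Matched.exists_equiv {r : Setoid V} {x y a b : V} (h : Matched T r x y)
    (ha : T.Adj x a) (hb : T.Adj y b) (hab : r a b) :
    ∃ σ : T.neighborSet x ≃ T.neighborSet y,
      (∀ z : T.neighborSet x, r (z : V) (σ z)) ∧ σ ⟨a, ha⟩ = ⟨b, hb⟩ := by
  classical
  obtain ⟨σ, hσ⟩ := h
  refine ⟨σ.trans (Equiv.swap (σ ⟨a, ha⟩) ⟨b, hb⟩), fun z => ?_, by simp⟩
  have h1 : r (σ ⟨a, ha⟩ : V) b := r.trans' (r.symm' (hσ ⟨a, ha⟩)) hab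
  rw [Equiv.trans_apply]
  rcases eq_or_ne (σ z) (σ ⟨a, ha⟩) with h | h
  · rw [h, Equiv.swap_apply_left]
    exact r.trans' (hσ z) (h ▸ h1)
  · rcases eq_or_ne (σ z) ⟨b, hb⟩ with h' | h'
    · rw [h', Equiv.swap_apply_right]
      have := hσ z
      rw [h'] at this
      exact r.trans' this (r.symm' h1)
    · rw [Equiv.swap_apply_of_ne_of_ne h h']
      exact hσ z

/-- The pair of images of a vertex `v` and of its predecessor `par v`, when the images `x'` of
the root `x` and `y'` of its predecessor are given, and `M p p' a a'` extends a map from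
`p ↦ p'`, `a ↦ a'` to the neighbours of `p`. -/
noncomputable def extendAlong (M : V → V → V → V → V → V) (par : V → V) (d : V → ℕ) (x : V)
    (hd : ∀ v, v ≠ x → d (par v) < d v) (x' y' : V) (v : V) : V × V :=
  open Classical in
  if _h : v = x then (x', y')
  else
    let q := extendAlong M par d x hd x' y' (par v)
    (M (par v) q.1 (par (par v)) q.2 v, q.1)
termination_by d v
decreasing_by exact hd v ‹_›

/-- If equivalent vertices of a tree have equivalent neighbours, then every bijection of two
edges that respects the equivalence extends to an automorphism that respects it. -/
theorem exists_iso_of_matched (hT : T.IsTree) {r : Setoid V}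
    (hr : ∀ x y, r x y → Matched T r x y) {x y x' y' : V} (hxy : T.Adj x y) (hxy' : T.Adj x' y')
    (hx : r x x') (hy : r y y') :
    ∃ γ : T ≃g T, γ x = x' ∧ γ y = y' ∧ ∀ z, r z (γ z) := by
  classical
  have hM : ∀ p p' a a' : V, ∃ m : V → V, r p p' → T.Adj p a → T.Adj p' a' → r a a' →
      Set.BijOn m (T.neighborSet p) (T.neighborSet p') ∧ (∀ z ∈ T.neighborSet p, r z (m z)) ∧
      m a = a' := by
    intro p p' a a'
    by_cases h : r p p' ∧ T.Adj p a ∧ T.Adj p' a' ∧ r a a'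
    · obtain ⟨h1, h2, h3, h4⟩ := h
      obtain ⟨σ, hσ, hσa⟩ := (hr p p' h1).exists_equiv h2 h3 h4
      refine ⟨fun z => if hz : z ∈ T.neighborSet p then σ ⟨z, hz⟩ else z,
        fun _ _ _ _ => ⟨⟨?_, ?_, ?_⟩, ?_, ?_⟩⟩
      · intro z hz
        simp only [dif_pos hz]
        exact (σ ⟨z, hz⟩).2
      · intro z hz w hw hzw
        simp only [dif_pos hz, dif_pos hw] at hzw
        exact congrArg Subtype.val (σ.injective (Subtype.ext hzw))
      · intro w hw
        refine ⟨σ.symm ⟨w, hw⟩, (σ.symm ⟨w, hw⟩).2, ?_⟩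
        simp only [dif_pos (σ.symm ⟨w, hw⟩).2]
        simp
      · intro z hz
        simp only [dif_pos hz]
        exact hσ ⟨z, hz⟩
      · have : a ∈ T.neighborSet p := h2
        simp only [dif_pos this, hσa]
    · exact ⟨id, fun h1 h2 h3 h4 => absurd ⟨h1, h2, h3, h4⟩ h⟩
  choose M hM using hM
  have hpar : ∀ v, ∃ p, T.Adj v p ∧ (v ≠ x → T.dist x v = T.dist x p + 1) ∧
      (v = x → p = y) := by
    intro v
    by_cases hv : v = x
    · subst hv
      exact ⟨y, hxy, fun h => absurd rfl h, fun _ => rfl⟩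
    · obtain ⟨p, hp, hd⟩ := exists_adj_dist_eq_add_one hT.connected hv
      exact ⟨p, hp, fun _ => hd, fun h => absurd h hv⟩
  choose par hadj hdist hroot using hpar
  have hlt : ∀ v, v ≠ x → T.dist x (par v) < T.dist x v := fun v hv => by
    rw [hdist v hv]; exact Nat.lt_succ_self _
  set G := extendAlong M par (T.dist x) x hlt x' y' with hG
  have hGx : G x = (x', y') := by
    rw [hG, extendAlong]; simp
  have hGv : ∀ v, v ≠ x → G v =
      (M (par v) (G (par v)).1 (par (par v)) (G (par v)).2 v, (G (par v)).1) := by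
    intro v hv
    rw [hG, extendAlong, dif_neg hv]
  -- the images of `v` and of its predecessor are adjacent and equivalent to `v`, `par v`
  have hinv : ∀ v, r v (G v).1 ∧ r (par v) (G v).2 ∧ T.Adj (G v).1 (G v).2 := by
    intro v
    induction hn : T.dist x v using Nat.strong_induction_on generalizing v with
    | _ n ih =>
      subst hn
      by_cases hv : v = x
      · subst hv
        rw [hGx, hroot v rfl]
        exact ⟨hx, hy, hxy'⟩
      · obtain ⟨h1, h2, h3⟩ := ih _ (hlt v hv) (par v) rfl
        obtain ⟨m1, m2, -⟩ := hM _ _ _ _ h1 (hadj (par v)) h3 h2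
        rw [hGv v hv]
        exact ⟨m2 v (hadj v).symm, h1, (m1.mapsTo (hadj v).symm : T.Adj _ _).symm⟩
  have hMv : ∀ v, _ := fun v =>
    hM v (G v).1 (par v) (G v).2 (hinv v).1 (hadj v) (hinv v).2.2 (hinv v).2.1
  have hloc : ∀ v, ∀ w ∈ T.neighborSet v, (G w).1 = M v (G v).1 (par v) (G v).2 w := by
    intro v w hw
    have hchild : w ≠ x → par w = v → (G w).1 = M v (G v).1 (par v) (G v).2 w := by
      intro h1 h2
      rw [hGv w h1, h2]
    rcases hT.dist_eq_dist_add_one_of_adj x hw with h | h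
    · have hv : v ≠ x := by rintro rfl; simp at h
      have : par v = w := eq_of_adj_of_dist hT (hadj v) hw (hdist v hv) h
      have h3 := (hMv v).2.2
      rw [this] at h3 ⊢
      rw [h3, hGv v hv, this]
    · have hw' : w ≠ x := by rintro rfl; simp at h
      exact hchild hw' (eq_of_adj_of_dist hT (hadj w) hw.symm (hdist w hw') h)
  obtain ⟨γ, hγ⟩ := exists_iso_of_bijOn hT (f := fun v => (G v).1)
    (fun v => (hMv v).1.congr fun w hw => (hloc v w hw).symm)
  refine ⟨γ, by rw [hγ, hGx], ?_, fun z => by rw [hγ]; exact (hinv z).1⟩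
  rw [hγ]
  show (G y).1 = y'
  rw [hloc x y hxy]
  have h3 := (hMv x).2.2
  rw [hroot x rfl, hGx] at h3
  rw [hroot x rfl, hGx]
  exact h3

theorem exists_iso_of_matched_vertex (hT : T.IsTree) {r : Setoid V}
    (hr : ∀ x y, r x y → Matched T r x y) {x x' : V} (hx : r x x') (hdeg : ∃ y, T.Adj x y) :
    ∃ γ : T ≃g T, γ x = x' ∧ ∀ z, r z (γ z) := by
  obtain ⟨y, hy⟩ := hdeg
  obtain ⟨y', hy', hyy'⟩ := (hr x x' hx).exists_adj hy
  obtain ⟨γ, h1, -, h2⟩ := exists_iso_of_matched hT hr hy hy' hx hyy'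
  exact ⟨γ, h1, h2⟩

end LocalIso

/-! ### Refinement sequences in which one class splits at a time -/

section Refinement

variable {V : Type u} {T : SimpleGraph V} {E : ℕ → Setoid V}

/-- The properties of the sequence of equivalence relations `[B_n(x)] = [B_n(y)]` of a Sturmian
coloring on which the structure of the quotient graph depends. -/
structure IsSturmianRefinement (T : SimpleGraph V) (E : ℕ → Setoid V) : Prop where
  mono : ∀ n x y, E (n + 1) x y → E n x y
  matched : ∀ n x y, E (n + 1) x y → Matched T (E n) x y
  card : ∀ n, Nat.card (Quotient (E n)) = n + 2

/-- Two vertices are equivalent in the limit if they are equivalent at every level. -/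
def limitSetoid (E : ℕ → Setoid V) : Setoid V where
  r x y := ∀ n, E n x y
  iseqv :=
    { refl := fun x n => (E n).refl' x
      symm := fun h n => (E n).symm' (h n)
      trans := fun h h' n => (E n).trans' (h n) (h' n) }

/-- The class of `x` at level `n` is divided at the next level; for colored balls this means that
the class is special. -/
def Splits (E : ℕ → Setoid V) (n : ℕ) (x : V) : Prop := ∃ y, E n x y ∧ ¬ E (n + 1) x y

/-- A set of vertices meets only finitely many limit classes. -/
def HasFewTypes (E : ℕ → Setoid V) (B : Set V) : Prop :=
  (Quotient.mk (limitSetoid E) '' B).Finite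

/-- The class of `x` at level `n` as a set. -/
def cell (E : ℕ → Setoid V) (n : ℕ) (x : V) : Set V := {y | E n x y}

theorem HasFewTypes.subset {B C : Set V} (h : HasFewTypes E B) (hC : C ⊆ B) : HasFewTypes E C :=
  Set.Finite.subset h (Set.image_mono hC)

theorem HasFewTypes.union {B C : Set V} (h : HasFewTypes E B) (hC : HasFewTypes E C) :
    HasFewTypes E (B ∪ C) := by
  rw [HasFewTypes, Set.image_union]
  exact Set.Finite.union h hC

theorem cell_eq_of_rel {n : ℕ} {x y : V} (h : E n x y) : cell E n x = cell E n y :=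
  Set.ext fun _ => ⟨fun h' => (E n).trans' ((E n).symm' h) h', fun h' => (E n).trans' h h'⟩

/-- A surjection between finite sets whose cardinalities differ by one identifies a single pair of
elements. -/
theorem exists_pair_of_card_eq_add_one {α β : Type*} [Finite α] {π : α → β} (hπ : Function.Surjective π)
    (hc : Nat.card α = Nat.card β + 1) :
    ∃ w w' : α, w ≠ w' ∧ π w = π w' ∧ ∀ u u', π u = π u' → u ≠ u' → u = w ∨ u' = w := by
  classical
  have : Finite β := Finite.of_surjective π hπ
  set s := Function.surjInv hπ
  have hs : ∀ b, π (s b) = b := Function.surjInv_eq hπ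
  have hinj : Function.Injective s := Function.injective_surjInv hπ
  have h1 : (Set.range s).ncard = Nat.card β := by
    rw [← Nat.card_coe_set_eq]
    exact Nat.card_congr (Equiv.ofInjective s hinj).symm
  have h2 := Set.ncard_add_ncard_compl (Set.range s)
  have h3 : (Set.range s)ᶜ.ncard = 1 := by omega
  obtain ⟨w, hw⟩ := Set.ncard_eq_one.1 h3
  have hwm : ∀ u, u ∉ Set.range s ↔ u = w := fun u => by
    rw [← Set.mem_compl_iff, hw, Set.mem_singleton_iff]
  refine ⟨w, s (π w), fun h => (hwm w).2 rfl ⟨_, h.symm⟩, (hs _).symm, fun u u' h hne => ?_⟩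
  by_contra! hcon
  obtain ⟨b, rfl⟩ := not_not.1 (mt (hwm u).1 hcon.1)
  obtain ⟨b', rfl⟩ := not_not.1 (mt (hwm u').1 hcon.2)
  rw [hs, hs] at h
  exact hne (h ▸ rfl)

namespace IsSturmianRefinement

theorem finite_quotient (hE : IsSturmianRefinement T E) (n : ℕ) : Finite (Quotient (E n)) :=
  Nat.finite_of_card_ne_zero (by rw [hE.card n]; omega)

theorem mono_le (hE : IsSturmianRefinement T E) {m n : ℕ} (hmn : m ≤ n) {x y : V}
    (h : E n x y) : E m x y := by
  induction n, hmn using Nat.le_induction with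
  | base => exact h
  | succ n _ ih => exact ih (hE.mono n x y h)

/-- Exactly one class splits at each level, and it splits into exactly two classes. -/
theorem exists_new_class (hE : IsSturmianRefinement T E) (n : ℕ) :
    ∃ w w' : V, E n w w' ∧ ¬ E (n + 1) w w' ∧
      ∀ u u', E n u u' → ¬ E (n + 1) u u' → E (n + 1) u w ∨ E (n + 1) u' w := by
  have := hE.finite_quotient (n + 1)
  let π : Quotient (E (n + 1)) → Quotient (E n) := Quotient.map id (hE.mono n)
  have hπ : Function.Surjective π := by
    rintro ⟨x⟩
    exact ⟨Quotient.mk _ x, rfl⟩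
  obtain ⟨w, w', h1, h2, h3⟩ :=
    exists_pair_of_card_eq_add_one hπ (by rw [hE.card, hE.card])
  induction w using Quotient.inductionOn with | _ w
  induction w' using Quotient.inductionOn with | _ w'
  refine ⟨w, w', Quotient.exact h2, fun h => h1 (Quotient.sound h), fun u u' h h' => ?_⟩
  rcases h3 (Quotient.mk _ u) (Quotient.mk _ u') (Quotient.sound h)
    (fun he => h' (Quotient.exact he)) with h4 | h4
  · exact Or.inl (Quotient.exact h4)
  · exact Or.inr (Quotient.exact h4)

theorem exists_splits (hE : IsSturmianRefinement T E) (n : ℕ) : ∃ x, Splits E n x := by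
  obtain ⟨w, w', h1, h2, -⟩ := hE.exists_new_class n
  exact ⟨w, w', h1, h2⟩

theorem rel_of_splits (hE : IsSturmianRefinement T E) {n : ℕ} {x y : V} (hx : Splits E n x)
    (hy : Splits E n y) : E n x y := by
  obtain ⟨w, w', -, -, h⟩ := hE.exists_new_class n
  have key : ∀ z, Splits E n z → E n z w := by
    rintro z ⟨z', h1, h2⟩
    rcases h z z' h1 h2 with h3 | h3
    · exact hE.mono _ _ _ h3
    · exact (E n).trans' h1 (hE.mono _ _ _ h3)
  exact (E n).trans' (key x hx) ((E n).symm' (key y hy))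

theorem rel_of_not_rel (hE : IsSturmianRefinement T E) {n : ℕ} {x y z : V} (hxy : E n x y)
    (hxz : E n x z) (hy : ¬ E (n + 1) x y) (hz : ¬ E (n + 1) x z) : E (n + 1) y z := by
  obtain ⟨w, w', -, -, h⟩ := hE.exists_new_class n
  by_contra hyz
  have h1 := h x y hxy hy
  have h2 := h x z hxz hz
  have h3 := h y z ((E n).trans' ((E n).symm' hxy) hxz) hyz
  have t : ∀ {a b}, E (n + 1) a w → E (n + 1) b w → E (n + 1) a b :=
    fun ha hb => (E (n + 1)).trans' ha ((E (n + 1)).symm' hb)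
  rcases h1 with h1 | h1
  · rcases h3 with h3 | h3
    · exact hy (t h1 h3)
    · exact hz (t h1 h3)
  · rcases h2 with h2 | h2
    · exact hy (t h2 h1)
    · exact hyz (t h1 h2)

theorem rel_succ_of_not_splits {n : ℕ} {x y : V} (hx : ¬ Splits E n x) (h : E n x y) :
    E (n + 1) x y := by
  by_contra hc
  exact hx ⟨y, h, hc⟩

/-- Vertices with the same limit class have neighbours with the same limit classes: one of the
finitely many bijections between their neighbours works for infinitely many levels. -/
theorem matched_limit [T.LocallyFinite] (hE : IsSturmianRefinement T E) {x y : V}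
    (h : limitSetoid E x y) : Matched T (limitSetoid E) x y := by
  choose σ hσ using fun n => hE.matched n x y (h (n + 1))
  obtain ⟨τ, hτ⟩ := Finite.exists_infinite_fiber σ
  rw [Set.infinite_coe_iff] at hτ
  refine ⟨τ, fun z n => ?_⟩
  obtain ⟨m, hm, hnm⟩ := hτ.exists_gt n
  have h1 := hσ m z
  have h2 : σ m = τ := hm
  rw [h2] at h1
  exact hE.mono_le hnm.le h1

theorem infinite_limit (hE : IsSturmianRefinement T E) : Infinite (Quotient (limitSetoid E)) := by
  by_contra hc
  rw [not_infinite_iff_finite] at hc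
  set N := Nat.card (Quotient (limitSetoid E))
  let π : Quotient (limitSetoid E) → Quotient (E N) := Quotient.map id fun x y h => h N
  have hπ : Function.Surjective π := by
    rintro ⟨x⟩
    exact ⟨Quotient.mk _ x, rfl⟩
  have := Nat.card_le_card_of_surjective π hπ
  rw [hE.card] at this
  omega

theorem hasFewTypes_neighbors [T.LocallyFinite] (hE : IsSturmianRefinement T E) {B : Set V}
    (hB : HasFewTypes E B) : HasFewTypes E {y | ∃ x ∈ B, T.Adj x y} := by
  refine (hB.biUnion (t := fun q => Quotient.mk (limitSetoid E) '' T.neighborSet q.out)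
    fun q _ => (T.neighborSet q.out).toFinite.image _).subset ?_
  rintro _ ⟨y, ⟨x, hx, hxy⟩, rfl⟩
  refine Set.mem_biUnion (Set.mem_image_of_mem _ hx) ?_
  obtain ⟨w, hw, hyw⟩ := (hE.matched_limit (Setoid.symm' _ (Quotient.mk_out x))).exists_adj hxy
  exact ⟨w, hw, Quotient.sound (Setoid.symm' _ hyw)⟩

/-- All members of a class that does not split have a neighbour in the class of `y` if one of them
has, so that the class has few types along with that of `y`. -/
theorem hasFewTypes_of_adj [T.LocallyFinite] (hE : IsSturmianRefinement T E) {n : ℕ} {x y : V}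
    (hxy : T.Adj x y) (hx : ¬ Splits E n x) (hy : HasFewTypes E (cell E n y)) :
    HasFewTypes E (cell E n x) := by
  refine (hE.hasFewTypes_neighbors hy).subset fun x' hx' => ?_
  obtain ⟨w, hw, hyw⟩ := (hE.matched n x x' (rel_succ_of_not_splits hx hx')).exists_adj hxy
  exact ⟨w, hyw, hw.symm⟩

/-- The class that splits contains infinitely many limit classes. Otherwise, by connectedness,
so few types would be found everywhere. -/
theorem not_hasFewTypes_of_splits [T.LocallyFinite] (hE : IsSturmianRefinement T E)
    (hT : T.Connected) {n : ℕ} {x : V} (hx : Splits E n x) : ¬ HasFewTypes E (cell E n x) := by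
  intro hfew
  have hall : ∀ y, HasFewTypes E (cell E n y) := by
    refine forall_of_adj_closed hT hfew fun y z hyz hy => ?_
    by_cases hz : Splits E n z
    · rwa [← cell_eq_of_rel (hE.rel_of_splits hx hz)]
    · exact hE.hasFewTypes_of_adj hyz.symm hz hy
  have := hE.finite_quotient n
  have := hE.infinite_limit
  have h1 : (Set.univ : Set (Quotient (limitSetoid E))).Finite := by
    refine (Set.finite_iUnion fun q : Quotient (E n) => hall q.out).subset ?_
    rintro ⟨x⟩ -
    refine Set.mem_iUnion.2 ⟨Quotient.mk _ x, x, ?_, rfl⟩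
    exact Quotient.mk_out (s := E n) x
  exact Set.infinite_univ h1

theorem hasFewTypes_mono (hE : IsSturmianRefinement T E) {m n : ℕ} (hmn : m ≤ n) {x : V}
    (h : HasFewTypes E (cell E m x)) : HasFewTypes E (cell E n x) :=
  h.subset fun _ hy => hE.mono_le hmn hy

/-- A class with few types never splits, so it is a single limit class. -/
theorem limit_of_hasFewTypes [T.LocallyFinite] (hE : IsSturmianRefinement T E)
    (hT : T.Connected) {n : ℕ} {x y : V} (hx : HasFewTypes E (cell E n x)) (hxy : E n x y) :
    limitSetoid E x y := by
  have h : ∀ m, n ≤ m → E m x y := by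
    intro m hm
    induction m, hm using Nat.le_induction with
    | base => exact hxy
    | succ m hm ih =>
      exact rel_succ_of_not_splits
        (fun hs => hE.not_hasFewTypes_of_splits hT hs (hE.hasFewTypes_mono hm hx)) ih
  intro m
  rcases le_total n m with hm | hm
  · exact h m hm
  · exact hE.mono_le hm hxy

theorem hasFewTypes_of_limit {n : ℕ} {x : V} (h : ∀ y, E n x y → limitSetoid E x y) :
    HasFewTypes E (cell E n x) := by
  refine (Set.finite_singleton (Quotient.mk (limitSetoid E) x)).subset ?_
  rintro _ ⟨y, hy, rfl⟩
  exact (Quotient.sound (h y hy)).symm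

/-- A vertex whose class splits only finitely often is eventually alone in its class. -/
theorem exists_hasFewTypes (hE : IsSturmianRefinement T E) {x : V}
    (h : {n | Splits E n x}.Finite) : ∃ n, HasFewTypes E (cell E n x) := by
  obtain ⟨N, hN⟩ := h.bddAbove
  refine ⟨N + 1, hasFewTypes_of_limit fun y hy => ?_⟩
  have h : ∀ m, N + 1 ≤ m → E m x y := by
    intro m hm
    induction m, hm using Nat.le_induction with
    | base => exact hy
    | succ m hm ih =>
      refine rel_succ_of_not_splits (fun hs => ?_) ih
      have : m ≤ N := hN hs
      omega
  intro m
  rcases le_total (N + 1) m with hm | hm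
  · exact h m hm
  · exact hE.mono_le hm hy

/-- If the class of `x` splits infinitely often, then `x` has neighbours in at most two limit
classes other than its own. -/
theorem card_neighbor_types_le_two [T.LocallyFinite] (hE : IsSturmianRefinement T E)
    (hT : T.Connected) {x : V} (hx : {n | Splits E n x}.Infinite) (y : Fin 3 → V)
    (hy : ∀ i, T.Adj x (y i)) (hxy : ∀ i, ¬ limitSetoid E x (y i))
    (hyy : ∀ i j, limitSetoid E (y i) (y j) → i = j) : False := by
  -- from level `n₀` on, the classes distinguish all limit classes in the 2-ball around `x`
  obtain ⟨n₀, hn₀⟩ : ∃ n₀, ∀ a ∈ ball T 2 x, ∀ b ∈ ball T 2 x,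
      E n₀ a b → limitSetoid E a b := by
    have hfin := finite_ball hT 2 x
    have h1 : ∀ p : V × V, ∃ n, E n p.1 p.2 → limitSetoid E p.1 p.2 := by
      intro p
      by_contra! hc
      exact (hc 0).2 fun n => (hc n).1
    choose f hf using h1
    obtain ⟨M, hM⟩ := ((hfin.prod hfin).image f).bddAbove
    refine ⟨M, fun a ha b hb hab => hf (a, b) (hE.mono_le ?_ hab)⟩
    exact hM (Set.mem_image_of_mem f (Set.mk_mem_prod ha hb))
  have hx2 : x ∈ ball T 2 x := by simp [ball]
  have hy2 : ∀ i, y i ∈ ball T 2 x := fun i => by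
    simp [ball, SimpleGraph.dist_eq_one_iff_adj.2 (hy i)]
  obtain ⟨n₁, hsp, hlt⟩ := hx.exists_gt n₀
  obtain ⟨n, rfl⟩ : ∃ n, n₁ = n + 1 := ⟨n₁ - 1, by omega⟩
  obtain ⟨z, hxz, hxz'⟩ := id hsp
  have key : ∀ i, Splits E n (y i) ∨ Splits E (n + 2) (y i) := by
    intro i
    by_contra! hc
    -- otherwise `z` also has a neighbour `w` in the class of `y i`, and even at the level
    -- `n + 3`, so that `y i` has a neighbour `z'` which shares its class with `z`, not with `x`
    obtain ⟨w, hzw, hyw⟩ := (hE.matched n x z hxz).exists_adj (hy i)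
    have h1 : ¬ Splits E (n + 1) (y i) := fun hs =>
      hxy i (hn₀ x hx2 _ (hy2 i) (hE.mono_le (by omega) (hE.rel_of_splits hsp hs)))
    have h2 := rel_succ_of_not_splits hc.2
      (rel_succ_of_not_splits h1 (rel_succ_of_not_splits hc.1 hyw))
    obtain ⟨z', hz', hzz'⟩ :=
      (hE.matched (n + 2) _ _ ((E (n + 2 + 1)).symm' h2)).exists_adj hzw.symm
    have h3 : E (n + 1) x z' := (E (n + 1)).trans' hxz (hE.mono _ _ _ hzz')
    have h4 : z' ∈ ball T 2 x := by
      have := dist_le_add_one hT x hz'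
      rw [SimpleGraph.dist_eq_one_iff_adj.2 (hy i)] at this
      exact this
    have h5 := hn₀ x hx2 z' h4 (hE.mono_le (by omega) h3)
    exact hxz' ((E (n + 2)).trans' (h5 _) ((E (n + 2)).symm' hzz'))
  have same : ∀ m, n₀ ≤ m → ∀ i j, Splits E m (y i) → Splits E m (y j) → i = j :=
    fun m hm i j hi hj => hyy i j (hn₀ _ (hy2 i) _ (hy2 j)
      (hE.mono_le hm (hE.rel_of_splits hi hj)))
  have s1 := same n (by omega)
  have s2 := same (n + 2) (by omega)
  rcases key 0 with h0 | h0 <;> rcases key 1 with h1 | h1 <;> rcases key 2 with h2 | h2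
  · exact absurd (s1 _ _ h0 h1) (by decide)
  · exact absurd (s1 _ _ h0 h1) (by decide)
  · exact absurd (s1 _ _ h0 h2) (by decide)
  · exact absurd (s2 _ _ h1 h2) (by decide)
  · exact absurd (s1 _ _ h1 h2) (by decide)
  · exact absurd (s2 _ _ h0 h2) (by decide)
  · exact absurd (s2 _ _ h0 h1) (by decide)
  · exact absurd (s2 _ _ h0 h1) (by decide)

/-- A neighbour of a class with few types has few types itself or lies in the splitting class. -/
theorem splits_of_boundary [T.LocallyFinite] (hE : IsSturmianRefinement T E) {n : ℕ} {a b : V}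
    (hab : T.Adj a b) (ha : HasFewTypes E (cell E n a)) (hb : ¬ HasFewTypes E (cell E n b)) :
    Splits E n b := by
  by_contra hs
  exact hb (hE.hasFewTypes_of_adj hab.symm hs ha)

/-- A class with few types at level `n` absorbs its neighbours at the next level: those members
of the splitting class which are adjacent to it get separated from the other members. -/
theorem hasFewTypes_succ_of_adj [T.LocallyFinite] (hE : IsSturmianRefinement T E) {n : ℕ}
    {a b : V} (hab : T.Adj a b) (ha : HasFewTypes E (cell E n a)) :
    HasFewTypes E (cell E (n + 1) b) := by
  refine (hE.hasFewTypes_neighbors ha).subset fun b' hb' => ?_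
  obtain ⟨w, hw, haw⟩ := (hE.matched n b b' hb').exists_adj hab.symm
  exact ⟨w, haw, hw.symm⟩

/-- The vertices whose class has few types at level `n + 1` but not at level `n` form a single limit
class, as one of the two parts of the special class has many types. -/
theorem limit_of_hasFewTypes_succ [T.LocallyFinite] (hE : IsSturmianRefinement T E)
    (hT : T.Connected) {n : ℕ} {x y : V} (hx : ¬ HasFewTypes E (cell E n x))
    (hy : ¬ HasFewTypes E (cell E n y)) (hx' : HasFewTypes E (cell E (n + 1) x))
    (hy' : HasFewTypes E (cell E (n + 1) y)) : limitSetoid E x y := by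
  have key : ∀ z, ¬ HasFewTypes E (cell E n z) → HasFewTypes E (cell E (n + 1) z) →
      Splits E n z := by
    intro z hz hz'
    by_contra hs
    exact hz (hz'.subset fun w hw => rel_succ_of_not_splits hs hw)
  have hxy := hE.rel_of_splits (key x hx hx') (key y hy hy')
  refine hE.limit_of_hasFewTypes hT hx' ?_
  by_contra hne
  refine hx ((hx'.union hy').subset fun z hz => ?_)
  by_cases hxz : E (n + 1) x z
  · exact Or.inl hxz
  · exact Or.inr (hE.rel_of_not_rel hxy hz hne hxz)

/-- If some class contains few types, then the limit classes can be listed as a ray: the union of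
the classes with few types grows at each level by one limit class, which is adjacent only to
the one added before. -/
theorem exists_ray_labelling [T.LocallyFinite] (hE : IsSturmianRefinement T E)
    (hT : T.Connected) (h : ∃ n x, HasFewTypes E (cell E n x)) :
    ∃ t : V → ℕ, (∀ x y, t x = t y ↔ limitSetoid E x y) ∧
      (∀ x y, T.Adj x y → t x ≤ t y + 1) ∧ ∀ i x, t x = i + 1 → ∃ y, T.Adj x y ∧ t y = i := by
  classical
  set n₀ := Nat.find h with hn₀
  obtain ⟨o, ho⟩ : ∃ o, HasFewTypes E (cell E n₀ o) := Nat.find_spec h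
  have hmin : ∀ m < n₀, ∀ x, ¬ HasFewTypes E (cell E m x) := fun m hm x hx =>
    Nat.find_min h hm ⟨x, hx⟩
  have hbase : ∀ x y, HasFewTypes E (cell E n₀ x) → HasFewTypes E (cell E n₀ y) →
      limitSetoid E x y := by
    intro x y hx hy
    rcases Nat.eq_zero_or_pos n₀ with h0 | h0
    · obtain ⟨s, hs⟩ := hE.exists_splits n₀
      have hxs : ¬ E n₀ x s := fun hc =>
        hE.not_hasFewTypes_of_splits hT hs (cell_eq_of_rel hc ▸ hx)
      have hys : ¬ E n₀ y s := fun hc =>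
        hE.not_hasFewTypes_of_splits hT hs (cell_eq_of_rel hc ▸ hy)
      refine hE.limit_of_hasFewTypes hT hx ?_
      by_contra hxy
      have := hE.finite_quotient n₀
      have h3 : Function.Injective ![Quotient.mk (E n₀) x, Quotient.mk (E n₀) y,
          Quotient.mk (E n₀) s] := by
        intro i j hij
        have e : ∀ a b, Quotient.mk (E n₀) a = Quotient.mk (E n₀) b → E n₀ a b :=
          fun a b => Quotient.exact
        fin_cases i <;> fin_cases j
        · rfl
        · exact absurd (e _ _ hij) hxy
        · exact absurd (e _ _ hij) hxs
        · exact absurd (e _ _ hij.symm) hxy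
        · rfl
        · exact absurd (e _ _ hij) hys
        · exact absurd (e _ _ hij.symm) hxs
        · exact absurd (e _ _ hij.symm) hys
        · rfl
      have := Nat.card_le_card_of_injective _ h3
      rw [hE.card, h0, Nat.card_eq_fintype_card, Fintype.card_fin] at this
      omega
    · obtain ⟨m, hm⟩ : ∃ m, n₀ = m + 1 := ⟨n₀ - 1, by omega⟩
      have := hmin m (by omega)
      rw [hm] at hx hy
      exact hE.limit_of_hasFewTypes_succ hT (this x) (this y) hx hy
  have hex : ∀ x, ∃ i, HasFewTypes E (cell E (n₀ + i) x) :=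
    forall_of_adj_closed hT (x := o) ⟨0, ho⟩ fun y z hyz ⟨i, hi⟩ =>
      ⟨i + 1, hE.hasFewTypes_succ_of_adj hyz hi⟩
  set t : V → ℕ := fun x => Nat.find (hex x) with ht
  have hle : ∀ x i, t x ≤ i ↔ HasFewTypes E (cell E (n₀ + i) x) := fun x i =>
    ⟨fun hi => hE.hasFewTypes_mono (Nat.add_le_add_left hi n₀) (Nat.find_spec (hex x)),
      fun hi => Nat.find_min' (hex x) hi⟩
  have hlim : ∀ x y, t x = t y ↔ limitSetoid E x y := by
    intro x y
    constructor
    · intro hxy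
      rcases hi : t x with _ | i
      · exact hbase x y ((hle x 0).1 hi.le) ((hle y 0).1 (hxy ▸ hi).le)
      · have hy : t y = i + 1 := hxy ▸ hi
        refine hE.limit_of_hasFewTypes_succ hT (n := n₀ + i) ?_ ?_ ((hle x (i + 1)).1 hi.le)
          ((hle y (i + 1)).1 hy.le)
        · rw [← hle]; omega
        · rw [← hle]; omega
    · intro hxy
      refine eq_of_forall_ge_iff fun i => ?_
      rw [hle, hle, cell_eq_of_rel (hxy _)]
  have hadj : ∀ x y, T.Adj x y → t x ≤ t y + 1 := fun x y hxy =>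
    (hle x (t y + 1)).2 (hE.hasFewTypes_succ_of_adj hxy.symm ((hle y (t y)).1 le_rfl))
  have hpred : ∀ i x, t x = i + 1 → ∃ y, T.Adj x y ∧ t y = i := by
    intro i x hx
    obtain ⟨a, b, hab, ha, hb⟩ := exists_adj_boundary hT (P := fun z => t z ≤ i) (x := o) (y := x)
      (le_trans ((hle o 0).2 ho) (Nat.zero_le i)) (by simp only [hx]; omega)
    have htb := hadj b a hab.symm
    have hbx : t b = t x := by omega
    obtain ⟨a', ha', haa'⟩ := (hE.matched_limit ((hlim b x).1 hbx)).exists_adj hab.symm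
    have h1 := (hlim a a').2 haa'
    have h2 := hadj x a' ha'
    exact ⟨a', ha', by omega⟩
  exact ⟨t, hlim, hadj, hpred⟩

/-- If some class contains few types, then at some level the only new distinctions made are
between few limit classes and the rest. -/
theorem exists_rel_succ [T.LocallyFinite] (hE : IsSturmianRefinement T E)
    (hT : T.Connected) (h : ∃ n x, HasFewTypes E (cell E n x)) :
    ∃ n, ∃ B : Set V, HasFewTypes E B ∧ ∀ x y, x ∉ B → y ∉ B → E n x y → E (n + 1) x y := by
  obtain ⟨n, o, ho⟩ := h
  obtain ⟨s, hs⟩ := hE.exists_splits n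
  obtain ⟨a, b, hab, ha, hb⟩ := exists_adj_boundary hT
    (P := fun z => HasFewTypes E (cell E n z)) ho (hE.not_hasFewTypes_of_splits hT hs)
  have hbs := hE.splits_of_boundary hab ha hb
  refine ⟨n, _, hE.hasFewTypes_neighbors ha, fun x y hx hy hxy => ?_⟩
  by_cases hsx : Splits E n x
  · have hbx := hE.rel_of_splits hbs hsx
    have key : ∀ z, z ∉ {y | ∃ x ∈ cell E n a, T.Adj x y} → ¬ E (n + 1) b z := by
      intro z hz hbz
      obtain ⟨w, hw, haw⟩ := (hE.matched n b z hbz).exists_adj hab.symm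
      exact hz ⟨w, haw, hw.symm⟩
    exact hE.rel_of_not_rel hbx ((E n).trans' hbx hxy) (key x hx) (key y hy)
  · exact rel_succ_of_not_splits hsx hxy

end IsSturmianRefinement

end Refinement

/-! ### Infinite graphs in which no vertex has three neighbours -/

section Line

variable {Q : Type u} {Y : SimpleGraph Q}

theorem hasse_nat_adj {i j : ℕ} : (SimpleGraph.hasse ℕ).Adj i j ↔ i + 1 = j ∨ j + 1 = i := by
  rw [SimpleGraph.hasse_adj, Order.covBy_iff_add_one_eq, Order.covBy_iff_add_one_eq]

theorem hasse_int_adj {i j : ℤ} : (SimpleGraph.hasse ℤ).Adj i j ↔ i + 1 = j ∨ j + 1 = i := by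
  rw [SimpleGraph.hasse_adj, Order.covBy_iff_add_one_eq, Order.covBy_iff_add_one_eq]

theorem nonempty_iso_hasse_nat [Infinite Q] (l : Q → ℕ) (hl : Function.Injective l)
    (hadj : ∀ p q, Y.Adj p q → l p ≤ l q + 1)
    (hpred : ∀ i p, l p = i + 1 → ∃ q, Y.Adj p q ∧ l q = i) :
    Nonempty (Y ≃g SimpleGraph.hasse ℕ) := by
  have hdown : ∀ j i, (∃ x, l x = i + j) → ∃ x, l x = i := by
    intro j
    induction j with
    | zero => exact fun i hi => hi
    | succ j ih =>
      rintro i ⟨x, hx⟩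
      obtain ⟨y, -, hy⟩ := hpred (i + j) x hx
      exact ih i ⟨y, hy⟩
  have hsurj : Function.Surjective l := by
    intro i
    by_contra hi
    have hbd : ∀ x, l x < i := fun x => by
      by_contra hc
      exact hi (hdown (l x - i) i ⟨x, by omega⟩)
    exact not_injective_infinite_finite (fun q => (⟨l q, hbd q⟩ : Fin i))
      fun q q' h => hl (congrArg Fin.val h)
  refine ⟨⟨Equiv.ofBijective l ⟨hl, hsurj⟩, ?_⟩⟩
  intro p q
  change (SimpleGraph.hasse ℕ).Adj (l p) (l q) ↔ Y.Adj p q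
  rw [hasse_nat_adj]
  constructor
  · rintro (h | h)
    · obtain ⟨p', hp', h1⟩ := hpred _ q h.symm
      exact hl h1 ▸ hp'.symm
    · obtain ⟨q', hq', h1⟩ := hpred _ p h.symm
      exact hl h1 ▸ hq'
  · intro h
    have h1 := hadj p q h
    have h2 := hadj q p h.symm
    have h3 : l p ≠ l q := fun he => h.ne (hl he)
    omega

/-- If in an infinite connected graph a bi-infinite path without backtracking contains all neighbours
of each of its vertices as the vertices before and after it, then the graph is a line. -/
theorem nonempty_iso_hasse_int [Infinite Q] (hY : Y.Connected) (z : ℤ → Q)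
    (hz : ∀ n, Y.Adj (z n) (z (n + 1))) (hz' : ∀ n, z (n + 2) ≠ z n)
    (hdeg : ∀ n q, Y.Adj (z (n + 1)) q → q = z n ∨ q = z (n + 2)) :
    Nonempty (Y ≃g SimpleGraph.hasse ℤ) := by
  have hdeg' : ∀ n q, Y.Adj (z n) q → q = z (n - 1) ∨ q = z (n + 1) := fun n q h => by
    have := hdeg (n - 1) q (by rwa [sub_add_cancel])
    rwa [show n - 1 + 2 = n + 1 by ring] at this
  have hsurj : Function.Surjective z := by
    refine forall_of_adj_closed hY (x := z 0) ⟨0, rfl⟩ ?_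
    rintro _ q h ⟨n, rfl⟩
    rcases hdeg' n q h with h | h
    · exact ⟨_, h.symm⟩
    · exact ⟨_, h.symm⟩
  -- a shortest repetition would close up to a cycle, which is all of `Y`
  have hne : ∀ (m : ℕ) (i : ℤ), 1 ≤ m → z i ≠ z (i + m) := by
    intro m
    induction m using Nat.strong_induction_on with
    | _ m ih =>
      intro i hm h
      obtain rfl | rfl | hm3 : m = 1 ∨ m = 2 ∨ 3 ≤ m := by omega
      · exact (hz i).ne (by simpa using h)
      · exact hz' i (by simpa using h.symm)
      have h1 : z (i - 1) = z (i + m - 1) := by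
        have hadj : Y.Adj (z i) (z (i + m - 1)) := by
          have := hz (i + m - 1)
          rw [sub_add_cancel, ← h] at this
          exact this.symm
        rcases hdeg' i _ hadj with h2 | h2
        · exact h2.symm
        · refine absurd h2.symm ?_
          have := ih (m - 2) (by omega) (i + 1) (by omega)
          rwa [show i + 1 + ((m - 2 : ℕ) : ℤ) = i + m - 1 by omega] at this
      have hall : ∀ q, ∃ n ∈ Set.Ico i (i + m), z n = q := by
        refine forall_of_adj_closed hY (x := z i) ⟨i, ⟨le_rfl, by omega⟩, rfl⟩ ?_
        rintro _ q hq ⟨n, ⟨hn1, hn2⟩, rfl⟩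
        rcases hdeg' n q hq with rfl | rfl
        · rcases eq_or_lt_of_le hn1 with rfl | hlt
          · exact ⟨i + m - 1, ⟨by omega, by omega⟩, h1.symm⟩
          · exact ⟨n - 1, ⟨by omega, by omega⟩, rfl⟩
        · rcases eq_or_ne (n + 1) (i + m) with he | he
          · exact ⟨i, ⟨le_rfl, by omega⟩, by rw [he, ← h]⟩
          · exact ⟨n + 1, ⟨by omega, by omega⟩, rfl⟩
      refine Set.infinite_univ (α := Q) (((Set.finite_Ico i (i + m)).image z).subset fun q _ => ?_)
      exact hall q
  have hinj : Function.Injective z := by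
    have key : ∀ i j : ℤ, i < j → z i ≠ z j := fun i j hij => by
      have := hne (j - i).toNat i (by omega)
      rwa [show i + ((j - i).toNat : ℤ) = j by omega] at this
    intro i j hij
    rcases lt_trichotomy i j with h | h | h
    · exact absurd hij (key i j h)
    · exact h
    · exact absurd hij.symm (key j i h)
  refine ⟨RelIso.symm ⟨Equiv.ofBijective z ⟨hinj, hsurj⟩, ?_⟩⟩
  intro i j
  change Y.Adj (z i) (z j) ↔ (SimpleGraph.hasse ℤ).Adj i j
  rw [hasse_int_adj]
  constructor
  · intro h
    rcases hdeg' i _ h with h | h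
    · have := hinj h; omega
    · have := hinj h; omega
  · rintro (rfl | rfl)
    · exact hz i
    · exact (hz j).symm

/-- An infinite connected graph in which no vertex has three neighbours is a ray or a line. -/
theorem nonempty_iso_hasse [Infinite Q] (hY : Y.Connected)
    (h3 : ∀ q (f : Fin 3 → Q), Function.Injective f → (∀ i, Y.Adj q (f i)) → False) :
    Nonempty (Y ≃g SimpleGraph.hasse ℕ) ∨ Nonempty (Y ≃g SimpleGraph.hasse ℤ) := by
  have h3' : ∀ q a b c, Y.Adj q a → Y.Adj q b → Y.Adj q c → a ≠ b → a ≠ c → b = c := by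
    intro q a b c ha hb hc hab hac
    by_contra hbc
    refine h3 q ![a, b, c] ?_ ?_
    · intro i j hij
      fin_cases i <;> fin_cases j <;> simp_all
    · intro i
      fin_cases i
      · exact ha
      · exact hb
      · exact hc
  by_cases hend : ∃ o, ∀ a b, Y.Adj o a → Y.Adj o b → a = b
  · left
    obtain ⟨o, ho⟩ := hend
    refine nonempty_iso_hasse_nat (Y.dist o) ?_ (fun p q h => dist_le_add_one hY o h.symm) ?_
    · have key : ∀ n x y, Y.dist o x = n → Y.dist o y = n → x = y := by
        intro n
        induction n with
        | zero =>
          intro x y hx hy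
          rw [hY.dist_eq_zero_iff] at hx hy
          rw [← hx, ← hy]
        | succ n ih =>
          intro x y hx hy
          obtain ⟨x', hx', hdx⟩ := exists_adj_dist_eq_add_one hY (r := o) (x := x)
            (by rintro rfl; simp at hx)
          obtain ⟨y', hy', hdy⟩ := exists_adj_dist_eq_add_one hY (r := o) (x := y)
            (by rintro rfl; simp at hy)
          obtain rfl := ih x' y' (by omega) (by omega)
          by_cases hxo : x' = o
          · subst hxo
            exact ho x y hx'.symm hy'.symm
          · obtain ⟨w, hw, hdw⟩ := exists_adj_dist_eq_add_one hY hxo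
            refine h3' x' w x y hw hx'.symm hy'.symm ?_ ?_
            · rintro rfl; omega
            · rintro rfl; omega
      exact fun x y hxy => key _ x y rfl hxy.symm
    · intro i p hp
      obtain ⟨q, hq, hd⟩ := exists_adj_dist_eq_add_one hY (r := o) (x := p)
        (by rintro rfl; simp at hp)
      exact ⟨q, hq, by omega⟩
  · right
    push Not at hend
    have hnext : ∀ d : Y.Dart, ∃ e : Y.Dart, e.fst = d.snd ∧ e.snd ≠ d.fst := by
      intro d
      obtain ⟨a, b, ha, hb, hab⟩ := hend d.snd
      by_cases h : a = d.fst
      · exact ⟨⟨(d.snd, b), hb⟩, rfl, fun h' => hab (h.trans h'.symm)⟩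
      · exact ⟨⟨(d.snd, a), ha⟩, rfl, h⟩
    choose s hs1 hs2 using hnext
    have hinv : ∀ d, (s (s d).symm).symm = d := by
      intro d
      have h1 : (s (s d).symm).fst = d.snd := by rw [hs1]; exact hs1 d
      have h2 : (s (s d).symm).snd ≠ (s d).snd := hs2 _
      have h3 : (s (s d).symm).snd = d.fst := by
        refine h3' d.snd (s d).snd _ _ ?_ ?_ d.adj.symm h2.symm (hs2 d)
        · have := (s d).adj
          rwa [hs1] at this
        · have := (s (s d).symm).adj
          rwa [h1] at this
      apply SimpleGraph.Dart.ext
      exact Prod.ext h3 h1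
    let σ : Equiv.Perm Y.Dart :=
      { toFun := s
        invFun := fun d => (s d.symm).symm
        left_inv := hinv
        right_inv := fun d => by
          have := hinv d.symm
          rw [← SimpleGraph.Dart.symm_symm (s _), this, SimpleGraph.Dart.symm_symm] }
    obtain ⟨o⟩ := hY.nonempty
    obtain ⟨a, b, ha, hb, hab⟩ := hend o
    let d : ℤ → Y.Dart := fun n => (σ ^ n) ⟨(o, a), ha⟩
    have hd : ∀ n, d (n + 1) = s (d n) := fun n => by
      show (σ ^ (n + 1)) _ = σ _
      rw [add_comm, zpow_add, zpow_one]
      rfl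
    have hfst : ∀ n, (d (n + 1)).fst = (d n).snd := fun n => by rw [hd, hs1]
    have hz : ∀ n, Y.Adj (d n).fst (d (n + 1)).fst := fun n => by
      rw [hfst]; exact (d n).adj
    have hz' : ∀ n, (d (n + 2)).fst ≠ (d n).fst := fun n => by
      rw [show n + 2 = n + 1 + 1 by ring, hfst, hd]
      exact hs2 _
    refine nonempty_iso_hasse_int hY (fun n => (d n).fst) hz hz' fun n q hq => ?_
    by_contra! hc
    have h4 := hz (n + 1)
    rw [show n + 1 + 1 = n + 2 by ring] at h4
    exact hc.2 (h3' _ _ _ _ (hz n).symm hq h4 hc.1.symm (hz' n).symm)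

end Line

/-! ### Isomorphisms of colored balls -/

section Balls

variable {V : Type u} {A : Type v} {T : SimpleGraph V} {φ : V → A}

theorem mem_ball_self (n : ℕ) (x : V) : x ∈ ball T n x := by simp [ball]

theorem ball_subset_ball (hT : T.Connected) {m n : ℕ} {x z : V} (h : m + T.dist x z ≤ n) :
    ball T m z ⊆ ball T n x := fun w hw => by
  have h1 : T.dist z w ≤ m := hw
  have := hT.dist_triangle (u := x) (v := z) (w := w)
  show T.dist x w ≤ n
  omega

/-- An isomorphism of balls does not increase distances from a vertex, as long as the geodesics
issuing from it stay in the ball. -/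
theorem dist_ballIso_le (hT : T.Connected) {N m : ℕ} {x y : V}
    (f : T.induce (ball T N x) ≃g T.induce (ball T N y)) (z : ball T N x)
    (hz : ball T m z ⊆ ball T N x) (w : ball T N x) (hw : (w : V) ∈ ball T m z) :
    T.dist (f z) (f w) ≤ T.dist z w := by
  induction hn : T.dist (z : V) w generalizing w with
  | zero =>
    have : z = w := Subtype.ext ((hT.dist_eq_zero_iff).1 hn)
    rw [this, T.dist_self]
  | succ n ih =>
    have hwz : (w : V) ≠ z := fun h => by rw [h, T.dist_self] at hn; omega
    obtain ⟨p, hp, hd⟩ := exists_adj_dist_eq_add_one hT hwz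
    have hw' : T.dist (z : V) w ≤ m := hw
    have hpm : p ∈ ball T m z := show T.dist (z : V) p ≤ m by omega
    have h1 := ih ⟨p, hz hpm⟩ hpm (by show T.dist (z : V) p = n; omega)
    have h2 : T.Adj (f ⟨p, hz hpm⟩ : V) (f w) :=
      f.map_adj_iff.2 (show T.Adj p w from hp.symm)
    have h3 := dist_le_add_one hT (f z : V) h2
    omega

theorem ballSetoid_of_ballIso (hT : T.Connected) {N m : ℕ} {x y : V}
    (f : T.induce (ball T N x) ≃g T.induce (ball T N y))
    (hf : ∀ z : ball T N x, φ (f z : V) = φ z) (z : ball T N x)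
    (hz : ball T m z ⊆ ball T N x) (hz' : ball T m (f z) ⊆ ball T N y) :
    ballSetoid T φ m z (f z) := by
  have h1 : ∀ w : ball T m (z : V), (f ⟨w, hz w.2⟩ : V) ∈ ball T m (f z) := fun w =>
    (dist_ballIso_le hT f z hz ⟨w, hz w.2⟩ w.2).trans w.2
  have h2 : ∀ w : ball T m (f z : V), (f.symm ⟨w, hz' w.2⟩ : V) ∈ ball T m z := fun w => by
    have := dist_ballIso_le hT f.symm (f z) hz' ⟨w, hz' w.2⟩ w.2
    rw [RelIso.symm_apply_apply] at this
    exact this.trans w.2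
  refine ⟨⟨⟨fun w => ⟨f ⟨w, hz w.2⟩, h1 w⟩, fun w => ⟨f.symm ⟨w, hz' w.2⟩, h2 w⟩, ?_, ?_⟩, ?_⟩, ?_⟩
  · intro w
    ext
    simp
  · intro w
    ext
    simp
  · intro a b
    exact f.map_adj_iff (v := ⟨a, hz a.2⟩) (w := ⟨b, hz b.2⟩)
  · intro w
    exact hf ⟨w, hz w.2⟩

theorem dist_iso (γ : T ≃g T) (hT : T.Connected) (x y : V) : T.dist (γ x) (γ y) = T.dist x y := by
  have key : ∀ (γ : T ≃g T) (x y : V), T.dist (γ x) (γ y) ≤ T.dist x y := by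
    intro γ x y
    obtain ⟨p, hp⟩ := hT.exists_walk_length_eq_dist x y
    rw [← hp, ← SimpleGraph.Walk.length_map γ.toHom p]
    exact T.dist_le _
  refine le_antisymm (key γ x y) ?_
  have := key γ.symm (γ x) (γ y)
  rwa [RelIso.symm_apply_apply, RelIso.symm_apply_apply] at this

/-- An automorphism of the tree that preserves the colors of an `n`-ball restricts to an
isomorphism of colored balls. -/
theorem ballSetoid_of_iso (hT : T.Connected) {n : ℕ} {x : V} (γ : T ≃g T)
    (h : ∀ z ∈ ball T n x, φ (γ z) = φ z) : ballSetoid T φ n x (γ x) := by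
  have h1 : ∀ z, z ∈ ball T n x ↔ γ z ∈ ball T n (γ x) := fun z => by
    show T.dist x z ≤ n ↔ T.dist (γ x) (γ z) ≤ n
    rw [dist_iso γ hT]
  refine ⟨⟨γ.toEquiv.subtypeEquiv h1, ?_⟩, fun z => h z z.2⟩
  intro a b
  exact γ.map_adj_iff

variable [T.LocallyFinite] {k : ℕ}

/-- An isomorphism of balls maps center to center, as the center is the only vertex of the
ball whose distance from all others is at most the radius. -/
theorem ballIso_center (hT : T.IsTree) (hk : T.IsRegularOfDegree k) (h2 : 2 ≤ k) {n : ℕ} {x y : V}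
    (f : T.induce (ball T n x) ≃g T.induce (ball T n y)) :
    (f ⟨x, mem_ball_self n x⟩ : V) = y := by
  by_contra hne
  obtain ⟨w, hw1, hw2⟩ := exists_dist_eq_add hT hk h2 (f ⟨x, mem_ball_self n x⟩) y n
  have hw : w ∈ ball T n y := hw1.le
  have h1 := dist_ballIso_le hT.connected f ⟨x, mem_ball_self n x⟩ (m := n) subset_rfl
    (f.symm ⟨w, hw⟩) (f.symm ⟨w, hw⟩).2
  rw [RelIso.apply_symm_apply] at h1
  have h3 : T.dist x (f.symm ⟨w, hw⟩) ≤ n := (f.symm ⟨w, hw⟩).2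
  have h4 := hT.connected.pos_dist_of_ne hne
  have h5 : T.dist (f ⟨x, mem_ball_self n x⟩ : V) w ≤ T.dist x (f.symm ⟨w, hw⟩) := h1
  omega

theorem color_eq_of_ballSetoid (hT : T.IsTree) (hk : T.IsRegularOfDegree k) (h2 : 2 ≤ k) {n : ℕ}
    {x y : V} (h : ballSetoid T φ n x y) : φ x = φ y := by
  obtain ⟨f, hf⟩ := h
  have := hf ⟨x, mem_ball_self n x⟩
  rw [ballIso_center hT hk h2 f] at this
  exact this.symm

theorem ballSetoid_mono (hT : T.IsTree) (hk : T.IsRegularOfDegree k) (h2 : 2 ≤ k) {n : ℕ} {x y : V}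
    (h : ballSetoid T φ (n + 1) x y) : ballSetoid T φ n x y := by
  obtain ⟨f, hf⟩ := h
  have hc := ballIso_center hT hk h2 f
  have := ballSetoid_of_ballIso hT.connected f hf ⟨x, mem_ball_self _ x⟩ (m := n)
    (ball_subset_ball hT.connected (by simp))
    (by rw [hc]; exact ball_subset_ball hT.connected (by simp))
  rwa [hc] at this

theorem ballSetoid_matched (hT : T.IsTree) (hk : T.IsRegularOfDegree k) (h2 : 2 ≤ k) {n : ℕ}
    {x y : V} (h : ballSetoid T φ (n + 1) x y) : Matched T (ballSetoid T φ n) x y := by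
  obtain ⟨f, hf⟩ := h
  have hc := ballIso_center hT hk h2 f
  have hc' := ballIso_center hT hk h2 f.symm
  have hnb : ∀ {a b : V}, T.Adj a b → b ∈ ball T (n + 1) a := fun {a b} h => by
    show T.dist a b ≤ n + 1
    rw [SimpleGraph.dist_eq_one_iff_adj.2 h]; omega
  have h1 : ∀ z : T.neighborSet x, T.Adj y (f ⟨z, hnb z.2⟩) := fun z => by
    have : T.Adj (f ⟨x, mem_ball_self _ x⟩ : V) (f ⟨z, hnb z.2⟩) :=
      f.map_adj_iff.2 (show T.Adj x z from z.2)
    rwa [hc] at this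
  have h1' : ∀ z : T.neighborSet y, T.Adj x (f.symm ⟨z, hnb z.2⟩) := fun z => by
    have : T.Adj (f.symm ⟨y, mem_ball_self _ y⟩ : V) (f.symm ⟨z, hnb z.2⟩) :=
      f.symm.map_adj_iff.2 (show T.Adj y z from z.2)
    rwa [hc'] at this
  refine ⟨⟨fun z => ⟨f ⟨z, hnb z.2⟩, h1 z⟩, fun z => ⟨f.symm ⟨z, hnb z.2⟩, h1' z⟩, ?_, ?_⟩, ?_⟩
  · intro z
    ext
    simp
  · intro z
    ext
    simp
  · intro z
    refine ballSetoid_of_ballIso hT.connected f hf ⟨z, hnb z.2⟩ ?_ ?_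
    · refine ball_subset_ball hT.connected ?_
      rw [SimpleGraph.dist_eq_one_iff_adj.2 (show T.Adj x z from z.2)]
    · refine ball_subset_ball hT.connected ?_
      rw [SimpleGraph.dist_eq_one_iff_adj.2 (h1 z)]

theorem two_le_degree_of_isSturmian (hT : T.IsTree) (hk : T.IsRegularOfDegree k)
    (hφ : IsSturmian T φ) : 2 ≤ k := by
  by_contra hlt
  obtain ⟨x⟩ := hT.connected.nonempty
  have hone : ∀ a b c, T.Adj a b → T.Adj a c → b = c := by
    intro a b c hb hc
    have : (T.neighborFinset a).card ≤ 1 := by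
      rw [T.card_neighborFinset_eq_degree, hk a]; omega
    exact Finset.card_le_one.1 this b (by simpa using hb) c (by simpa using hc)
  have hall : ∀ y, y = x ∨ T.Adj x y := by
    refine forall_of_adj_closed hT.connected (Or.inl rfl) ?_
    rintro y z hyz (rfl | h)
    · exact Or.inr hyz
    · exact Or.inl (hone y z x hyz h.symm)
  have h1 := hφ 1
  rw [subwordComplexity] at h1
  let g : Bool → Quotient (ballSetoid T φ 1) := fun b =>
    Quotient.mk _ (open Classical in if h : b = true ∧ ∃ y, T.Adj x y then h.2.choose else x)
  have hg : Function.Surjective g := by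
    rintro ⟨y⟩
    rcases hall y with rfl | h
    · exact ⟨false, by simp [g]; rfl⟩
    · refine ⟨true, ?_⟩
      have he : ∃ y, T.Adj x y := ⟨y, h⟩
      have : g true = Quotient.mk _ he.choose := by simp [g, he]
      rw [this, hone x _ y he.choose_spec h]
      rfl
  have := Nat.card_le_card_of_surjective g hg
  rw [h1, Nat.card_eq_fintype_card, Fintype.card_bool] at this
  omega

theorem IsSturmian.isSturmianRefinement (hT : T.IsTree) (hk : T.IsRegularOfDegree k)
    (hφ : IsSturmian T φ) : IsSturmianRefinement T (ballSetoid T φ) where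
  mono _ _ _ h := ballSetoid_mono hT hk (two_le_degree_of_isSturmian hT hk hφ) h
  matched _ _ _ h := ballSetoid_matched hT hk (two_le_degree_of_isSturmian hT hk hφ) h
  card := hφ

end Balls

/-! ### The quotient graph -/

section QuotientGraph

variable {V : Type u} {A : Type v} {T : SimpleGraph V} {φ : V → A}

theorem quotientProj_eq_iff {Γ : Subgroup (T ≃g T)} {x y : V} :
    quotientProj T Γ x = quotientProj T Γ y ↔ vertSetoid T Γ x y :=
  ⟨fun h => Quotient.exact h, fun h => Quotient.sound h⟩

theorem quotientProj_surjective (Γ : Subgroup (T ≃g T)) :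
    Function.Surjective (quotientProj T Γ) := by
  rintro ⟨x⟩
  exact ⟨x, rfl⟩

/-- The simple graph underlying the quotient graph, in which loops and multiple edges are
ignored. -/
def quotientSimpleGraph (T : SimpleGraph V) (Γ : Subgroup (T ≃g T)) :
    SimpleGraph (quotientGraph T Γ).Vert where
  Adj p q := p ≠ q ∧ ∃ x y, T.Adj x y ∧ quotientProj T Γ x = p ∧ quotientProj T Γ y = q
  symm := ⟨fun _ _ ⟨h, x, y, hxy, hx, hy⟩ => ⟨h.symm, y, x, hxy.symm, hy, hx⟩⟩
  loopless := ⟨fun _ h => h.1 rfl⟩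

theorem quotientSimpleGraph_connected (hT : T.Connected) (Γ : Subgroup (T ≃g T)) :
    (quotientSimpleGraph T Γ).Connected := by
  obtain ⟨o⟩ := hT.nonempty
  have h : ∀ x, (quotientSimpleGraph T Γ).Reachable (quotientProj T Γ o) (quotientProj T Γ x) := by
    refine forall_of_adj_closed hT (SimpleGraph.Reachable.refl _) fun y z hyz hy => ?_
    by_cases he : quotientProj T Γ y = quotientProj T Γ z
    · rwa [← he]
    · exact hy.trans (SimpleGraph.Adj.reachable ⟨he, y, z, hyz, rfl, rfl⟩)
  have : Nonempty (quotientGraph T Γ).Vert := ⟨quotientProj T Γ o⟩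
  refine ⟨fun p q => ?_⟩
  obtain ⟨x, rfl⟩ := quotientProj_surjective Γ p
  obtain ⟨y, rfl⟩ := quotientProj_surjective Γ q
  exact (h x).symm.trans (h y)

theorem withLoops_edge_ext {ι : Type w} {G : SimpleGraph ι} {S : Set ι}
    {e e' : (withLoops G S).Edge} (h : (withLoops G S).src e = (withLoops G S).src e')
    (h' : (withLoops G S).src ((withLoops G S).rev e) =
      (withLoops G S).src ((withLoops G S).rev e')) : e = e' := by
  rcases e with d | s <;> rcases e' with d' | s'
  · have h1 : d.fst = d'.fst := h
    have h2 : d.snd = d'.snd := h'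
    exact congrArg Sum.inl (SimpleGraph.Dart.ext _ _ (Prod.ext h1 h2))
  · have h1 : d.fst = s'.1 := h
    have h2 : d.snd = s'.1 := h'
    exact absurd (h1.trans h2.symm) d.adj.ne
  · have h1 : s.1 = d'.fst := h
    have h2 : s.1 = d'.snd := h'
    exact absurd (h1.symm.trans h2) d'.adj.ne
  · have h1 : s.1 = s'.1 := h
    exact congrArg Sum.inr (Subtype.ext h1)

/-- If the orbit of an edge is determined by the orbits of its endpoints, then the quotient graph
is its underlying simple graph with some half-edges attached. -/
theorem exists_iso_withLoops {ι : Type w} {G : SimpleGraph ι} {Γ : Subgroup (T ≃g T)}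
    (hedge : ∀ d e : T.Dart, vertSetoid T Γ d.fst e.fst → vertSetoid T Γ d.snd e.snd →
      edgeSetoid T Γ d e)
    (f : quotientSimpleGraph T Γ ≃g G) :
    ∃ S : Set ι, Nonempty ((quotientGraph T Γ).Iso (withLoops G S)) := by
  set π := quotientProj T Γ with hπ
  set S : Set ι := {i | ∃ d : T.Dart, f (π d.fst) = i ∧ f (π d.snd) = i}
  have hex : ∀ d : T.Dart, ∃ e : (withLoops G S).Edge, (withLoops G S).src e = f (π d.fst) ∧
      (withLoops G S).src ((withLoops G S).rev e) = f (π d.snd) := by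
    intro d
    by_cases h : π d.fst = π d.snd
    · exact ⟨Sum.inr ⟨f (π d.fst), d, rfl, by rw [h]⟩, rfl, congrArg f h⟩
    · exact ⟨Sum.inl ⟨(f (π d.fst), f (π d.snd)),
        f.map_adj_iff.2 ⟨h, d.fst, d.snd, d.adj, rfl, rfl⟩⟩, rfl, rfl⟩
  choose F hsrc hsrc' using hex
  have hF : ∀ d e, F d = F e ↔ π d.fst = π e.fst ∧ π d.snd = π e.snd := by
    intro d e
    constructor
    · intro h
      refine ⟨f.injective ?_, f.injective ?_⟩
      · rw [← hsrc, ← hsrc, h]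
      · rw [← hsrc', ← hsrc', h]
    · rintro ⟨h1, h2⟩
      refine withLoops_edge_ext ?_ ?_
      · rw [hsrc, hsrc, h1]
      · rw [hsrc', hsrc', h2]
  have hrev : ∀ d, (withLoops G S).rev (F d) = F d.symm := fun d =>
    withLoops_edge_ext ((hsrc' d).trans (hsrc d.symm).symm)
      (by rw [(withLoops G S).rev_rev, hsrc, hsrc']; rfl)
  have hr : ∀ d e : T.Dart, edgeSetoid T Γ d e ↔ F d = F e := by
    intro d e
    rw [hF, hπ, quotientProj_eq_iff, quotientProj_eq_iff]
    refine ⟨?_, fun h => hedge d e h.1 h.2⟩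
    rintro ⟨γ, hγ, h1, h2⟩
    exact ⟨⟨γ, hγ, h1⟩, ⟨γ, hγ, h2⟩⟩
  let F' : (quotientGraph T Γ).Edge → (withLoops G S).Edge :=
    Quotient.lift F fun d e h => (hr d e).1 h
  have hF' : Function.Bijective F' := by
    constructor
    · rintro ⟨d⟩ ⟨e⟩ h
      exact Quotient.sound ((hr d e).2 h)
    · rintro (g | ⟨i, d, h1, h2⟩)
      · obtain ⟨-, x, y, hxy, hx, hy⟩ : (quotientSimpleGraph T Γ).Adj (f.symm g.fst)
            (f.symm g.snd) := f.symm.map_adj_iff.2 g.adj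
        refine ⟨Quotient.mk _ ⟨(x, y), hxy⟩, withLoops_edge_ext ?_ ?_⟩
        · exact ((hsrc _).trans (congrArg f hx)).trans (f.apply_symm_apply _)
        · exact ((hsrc' _).trans (congrArg f hy)).trans (f.apply_symm_apply _)
      · exact ⟨Quotient.mk _ d, withLoops_edge_ext ((hsrc d).trans h1) ((hsrc' d).trans h2)⟩
  refine ⟨S, ⟨⟨f.toEquiv, Equiv.ofBijective F' hF', ?_, ?_⟩⟩⟩
  · rintro ⟨d⟩
    exact hsrc d
  · rintro ⟨d⟩
    exact hrev d

variable [T.LocallyFinite] {k : ℕ}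

/-- Two vertices lie in the same orbit if and only if their balls of every radius are isomorphic. -/
theorem vertSetoid_colorAut (hT : T.IsTree) (hk : T.IsRegularOfDegree k) (hφ : IsSturmian T φ) :
    vertSetoid T (colorAut T φ) = limitSetoid (ballSetoid T φ) := by
  have h2 := two_le_degree_of_isSturmian hT hk hφ
  have hE := hφ.isSturmianRefinement hT hk
  ext x y
  constructor
  · rintro ⟨γ, hγ, rfl⟩ n
    exact ballSetoid_of_iso hT.connected γ fun z _ => hγ z
  · intro h
    obtain ⟨z, hz, -⟩ := exists_adj_ne hk h2 x x
    obtain ⟨γ, h1, h3⟩ :=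
      exists_iso_of_matched_vertex hT (fun a b => hE.matched_limit) h ⟨z, hz⟩
    exact ⟨γ, fun a => (color_eq_of_ballSetoid hT hk h2 (h3 a 0)).symm, h1⟩

theorem edgeSetoid_colorAut (hT : T.IsTree) (hk : T.IsRegularOfDegree k) (hφ : IsSturmian T φ)
    (d e : T.Dart) (h1 : vertSetoid T (colorAut T φ) d.fst e.fst)
    (h2 : vertSetoid T (colorAut T φ) d.snd e.snd) : edgeSetoid T (colorAut T φ) d e := by
  rw [vertSetoid_colorAut hT hk hφ] at h1 h2
  obtain ⟨γ, h3, h4, h5⟩ := exists_iso_of_matched hT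
    (fun a b => (hφ.isSturmianRefinement hT hk).matched_limit) d.adj e.adj h1 h2
  exact ⟨γ, fun a => (color_eq_of_ballSetoid hT hk (two_le_degree_of_isSturmian hT hk hφ)
    (h5 a 0)).symm, h3, h4⟩

theorem quotientProj_colorAut_eq_iff (hT : T.IsTree) (hk : T.IsRegularOfDegree k)
    (hφ : IsSturmian T φ) {x y : V} :
    quotientProj T (colorAut T φ) x = quotientProj T (colorAut T φ) y ↔
      limitSetoid (ballSetoid T φ) x y := by
  rw [quotientProj_eq_iff, vertSetoid_colorAut hT hk hφ]

theorem infinite_quotientGraph_vert (hT : T.IsTree) (hk : T.IsRegularOfDegree k)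
    (hφ : IsSturmian T φ) : Infinite (quotientGraph T (colorAut T φ)).Vert := by
  have := (hφ.isSturmianRefinement hT hk).infinite_limit
  rw [← vertSetoid_colorAut hT hk hφ] at this
  exact this

theorem isRayWithLoops_of_hasFewTypes (hT : T.IsTree) (hk : T.IsRegularOfDegree k)
    (hφ : IsSturmian T φ) (h : ∃ n x, HasFewTypes (ballSetoid T φ) (cell (ballSetoid T φ) n x)) :
    (quotientGraph T (colorAut T φ)).IsRayWithLoops := by
  have := infinite_quotientGraph_vert hT hk hφ
  obtain ⟨t, h1, h2, h3⟩ := (hφ.isSturmianRefinement hT hk).exists_ray_labelling hT.connected h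
  have hl : ∀ x y, vertSetoid T (colorAut T φ) x y → t x = t y := fun x y hxy => by
    rwa [h1, ← vertSetoid_colorAut hT hk hφ]
  obtain ⟨f⟩ : Nonempty (quotientSimpleGraph T (colorAut T φ) ≃g SimpleGraph.hasse ℕ) := by
    refine nonempty_iso_hasse_nat (Quotient.lift t hl) ?_ ?_ ?_
    · rintro ⟨x⟩ ⟨y⟩ hxy
      exact (quotientProj_colorAut_eq_iff hT hk hφ).2 ((h1 x y).1 hxy)
    · rintro _ _ ⟨-, x, y, hxy, rfl, rfl⟩
      exact h2 x y hxy
    · rintro i ⟨x⟩ hx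
      obtain ⟨y, hy, hyi⟩ := h3 i x hx
      refine ⟨quotientProj T _ y, ⟨fun hc => ?_, x, y, hy, rfl, rfl⟩, hyi⟩
      have h4 : t x = t y := (h1 x y).2 ((quotientProj_colorAut_eq_iff hT hk hφ).1 hc)
      have h5 : t x = i + 1 := hx
      omega
  exact exists_iso_withLoops (edgeSetoid_colorAut hT hk hφ) f

theorem exists_hasFewTypes_of_isBoundedType (hT : T.IsTree) (hk : T.IsRegularOfDegree k)
    (hφ : IsSturmian T φ) (h : IsBoundedType T φ) :
    ∃ n x, HasFewTypes (ballSetoid T φ) (cell (ballSetoid T φ) n x) := by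
  obtain ⟨x, hx⟩ := h
  obtain ⟨n, hn⟩ := (hφ.isSturmianRefinement hT hk).exists_hasFewTypes
    (hx.subset fun n ⟨y, h1, h2⟩ => ⟨x, y, rfl, (Quotient.sound h1).symm,
      fun hc => h2 (Quotient.exact hc)⟩)
  exact ⟨n, x, hn⟩

theorem isRayWithLoops_or_isLineWithLoops (hT : T.IsTree) (hk : T.IsRegularOfDegree k)
    (hφ : IsSturmian T φ) : (quotientGraph T (colorAut T φ)).IsRayWithLoops ∨
      (quotientGraph T (colorAut T φ)).IsLineWithLoops := by
  have hE := hφ.isSturmianRefinement hT hk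
  by_cases hb : ∃ x, {n | Splits (ballSetoid T φ) n x}.Finite
  · obtain ⟨x, hx⟩ := hb
    obtain ⟨n, hn⟩ := hE.exists_hasFewTypes hx
    exact Or.inl (isRayWithLoops_of_hasFewTypes hT hk hφ ⟨n, x, hn⟩)
  · push Not at hb
    have := infinite_quotientGraph_vert hT hk hφ
    have hiff := fun {x y} => quotientProj_colorAut_eq_iff hT hk hφ (x := x) (y := y)
    have hY := quotientSimpleGraph_connected hT.connected (colorAut T φ)
    have h3 : ∀ q (f : Fin 3 → (quotientGraph T (colorAut T φ)).Vert), Function.Injective f →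
        (∀ i, (quotientSimpleGraph T (colorAut T φ)).Adj q (f i)) → False := by
      intro q f hf hadj
      obtain ⟨x, rfl⟩ := quotientProj_surjective _ q
      -- neighbours of an orbit are represented by neighbours of any of its points
      have hlift : ∀ i, ∃ y, T.Adj x y ∧ quotientProj T (colorAut T φ) y = f i ∧
          ¬ limitSetoid (ballSetoid T φ) x y := by
        intro i
        obtain ⟨hne, a, b, hab, ha, hb⟩ := hadj i
        obtain ⟨y, hy, hby⟩ := (hE.matched_limit (hiff.1 ha)).exists_adj hab
        have h1 := hiff.2 hby
        exact ⟨y, hy, by rw [← h1, hb], fun hc => hne (by rw [hiff.2 hc, ← h1, hb])⟩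
      choose y hy1 hy2 hy3 using hlift
      refine hE.card_neighbor_types_le_two hT.connected (hb x) y hy1 hy3 fun i j hij => hf ?_
      rw [← hy2, ← hy2, hiff.2 hij]
    rcases nonempty_iso_hasse hY h3 with ⟨⟨f⟩⟩ | ⟨⟨f⟩⟩
    · exact Or.inl (exists_iso_withLoops (edgeSetoid_colorAut hT hk hφ) f)
    · exact Or.inr (exists_iso_withLoops (edgeSetoid_colorAut hT hk hφ) f)

end QuotientGraph

/-! ### Eventually periodic colorings have finite classes -/

section EventuallyPeriodic

variable {V : Type u} {A : Type v} {T : SimpleGraph V} {φ : V → A}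

theorem exists_reachable_boundary (hT : T.Connected) {K : Set V} (hK : K.Nonempty) {x : V}
    (hx : x ∈ Kᶜ) : ∃ y, ∃ hy : y ∈ Kᶜ, (∃ z ∈ K, T.Adj z y) ∧
      (T.induce Kᶜ).Reachable ⟨x, hx⟩ ⟨y, hy⟩ := by
  obtain ⟨z, hz⟩ := hK
  obtain ⟨p⟩ := hT.preconnected x z
  induction p with
  | nil => exact absurd hz hx
  | @cons a b c hab q ih =>
    by_cases hb : b ∈ K
    · exact ⟨a, hx, ⟨b, hb, hab.symm⟩, SimpleGraph.Reachable.refl _⟩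
    · obtain ⟨y, hy, h1, h2⟩ := ih hb hz
      have hadj : (T.induce Kᶜ).Adj ⟨a, hx⟩ ⟨b, hb⟩ := hab
      exact ⟨y, hy, h1, hadj.reachable.trans h2⟩

theorem finite_connectedComponent_compl [T.LocallyFinite] (hT : T.Connected) {K : Set V}
    (hK : K.Nonempty) (hfin : K.Finite) : Finite (T.induce Kᶜ).ConnectedComponent := by
  have h1 : {y : ↥(Kᶜ) | ∃ z ∈ K, T.Adj z y}.Finite := by
    refine Set.Finite.preimage (f := Subtype.val) Subtype.val_injective.injOn
      (s := {y | ∃ z ∈ K, T.Adj z y}) ?_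
    refine (hfin.biUnion fun z _ => (T.neighborSet z).toFinite).subset ?_
    rintro y ⟨z, hz, hzy⟩
    exact Set.mem_biUnion hz hzy
  have := h1.to_subtype
  refine Finite.of_surjective
    (fun y : {y : ↥(Kᶜ) | ∃ z ∈ K, T.Adj z y} => (T.induce Kᶜ).connectedComponentMk y.1) ?_
  intro C
  induction C using SimpleGraph.ConnectedComponent.ind with
  | _ x =>
    obtain ⟨y, hy, h2, h3⟩ := exists_reachable_boundary hT hK x.2
    exact ⟨⟨⟨y, hy⟩, h2⟩, (SimpleGraph.ConnectedComponent.sound h3).symm⟩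

theorem reachable_of_ball_subset (hT : T.Connected) {K : Set V} {n : ℕ} {y : V}
    (hy : ball T n y ⊆ Kᶜ) {z : V} (hz : z ∈ ball T n y) :
    (T.induce Kᶜ).Reachable ⟨y, hy (mem_ball_self n y)⟩ ⟨z, hy hz⟩ := by
  induction hd : T.dist y z generalizing z with
  | zero =>
    obtain rfl := (hT.dist_eq_zero_iff).1 hd
    exact SimpleGraph.Reachable.refl _
  | succ m ih =>
    obtain ⟨p, hp, hdp⟩ := exists_adj_dist_eq_add_one hT (r := y) (x := z)
      (by rintro rfl; simp at hd)
    have hz' : T.dist y z ≤ n := hz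
    have hpb : p ∈ ball T n y := show T.dist y p ≤ n by omega
    have hadj : (T.induce Kᶜ).Adj ⟨p, hy hpb⟩ ⟨z, hy hz⟩ := hp.symm
    exact (ih hpb (by omega)).trans hadj.reachable

/-- For an eventually periodic coloring the number of classes of `n`-balls disjoint from the
exceptional subtree is bounded independently of `n`. As the number of all classes is not, some
class occurs only near the exceptional subtree. -/
theorem exists_finite_cell [T.LocallyFinite] (hT : T.Connected) (hφ : IsSturmian T φ)
    (h : IsEventuallyPeriodic T φ) : ∃ n x, (cell (ballSetoid T φ) n x).Finite := by
  obtain ⟨K, hfin, hconn, hψ⟩ := h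
  have hK : K.Nonempty := Set.nonempty_coe_sort.1 hconn.nonempty
  choose ψ hper hagree using hψ
  choose Γ hΓ _ hΓψ using hper
  have := finite_connectedComponent_compl hT hK hfin
  set N := Nat.card (Σ C, (quotientGraph T (Γ C)).Vert)
  by_contra! hinf
  have hdeep : ∀ q : Quotient (ballSetoid T φ N), ∃ y, ball T N y ⊆ Kᶜ ∧
      Quotient.mk (ballSetoid T φ N) y = q := by
    rintro ⟨x⟩
    by_contra! hc
    refine hinf N x ((hfin.biUnion fun z _ => finite_ball hT N z).subset fun y hy => ?_)
    by_contra hy'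
    refine hc y (fun z hz hzK => hy' ?_) (Quotient.sound hy).symm
    refine Set.mem_biUnion hzK ?_
    show T.dist z y ≤ N
    rw [T.dist_comm]
    exact hz
  choose y hy hyq using hdeep
  let C : Quotient (ballSetoid T φ N) → (T.induce Kᶜ).ConnectedComponent := fun q =>
    (T.induce Kᶜ).connectedComponentMk ⟨y q, hy q (mem_ball_self N _)⟩
  have hψφ : ∀ q, ∀ z ∈ ball T N (y q), ψ (C q) z = φ z := fun q z hz =>
    hagree (C q) ⟨z, hy q hz⟩
      (SimpleGraph.ConnectedComponent.sound (reachable_of_ball_subset hT (hy q) hz)).symm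
  let g : Quotient (ballSetoid T φ N) → Σ C, (quotientGraph T (Γ C)).Vert := fun q =>
    ⟨C q, quotientProj T (Γ (C q)) (y q)⟩
  have hg : Function.Injective g := by
    intro p q hpq
    have h1 : C p = C q := congrArg Sigma.fst hpq
    have h2 : quotientProj T (Γ (C q)) (y p) = quotientProj T (Γ (C q)) (y q) := by
      have h3 := (Sigma.mk.inj_iff.1 hpq).2
      rw [h1] at h3
      exact eq_of_heq h3
    obtain ⟨γ, hγ, hγy⟩ := quotientProj_eq_iff.1 h2
    rw [← hyq p, ← hyq q, ← hγy]
    refine Quotient.sound (ballSetoid_of_iso hT γ fun z hz => ?_)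
    have h3 : γ z ∈ ball T N (y q) := by
      show T.dist (y q) (γ z) ≤ N
      rw [← hγy, dist_iso γ hT]
      exact hz
    rw [← hψφ q _ h3, ← hψφ p z hz, h1, hΓψ _ γ hγ]
  have h1 := Nat.card_le_card_of_injective g hg
  have h2 : Nat.card (Quotient (ballSetoid T φ N)) = N + 2 := hφ N
  omega

/-- If one class at some level is finite, then so are all limit classes: neighbours of a
finite limit class form finite limit classes. -/
theorem finite_limit_class [T.LocallyFinite] (hT : T.Connected) {E : ℕ → Setoid V}
    (hE : IsSturmianRefinement T E) {n : ℕ} {x : V} (h : (cell E n x).Finite) (y : V) :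
    {z | limitSetoid E y z}.Finite := by
  refine forall_of_adj_closed hT (P := fun y => {z | limitSetoid E y z}.Finite) (x := x)
    (h.subset fun z hz => hz n) (fun a b hab ha => ?_) y
  refine (ha.biUnion fun z _ => (T.neighborSet z).toFinite).subset fun w hw => ?_
  obtain ⟨z, hz, haz⟩ := (hE.matched_limit hw).exists_adj hab.symm
  exact Set.mem_biUnion haz hz.symm

end EventuallyPeriodic

/-! ### Radial labellings and the indices of the quotient ray -/

section Radial

variable {V : Type u} {T : SimpleGraph V}

/-- A labelling of the vertices of a graph by natural numbers behaves like the distance from a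
vertex or from an edge: labels of neighbours differ by one unless both vanish, every vertex with
positive label has a neighbour with smaller label, and every vertex has at most one neighbour
whose label is not larger. -/
structure IsRadial (T : SimpleGraph V) (t : V → ℕ) : Prop where
  adj : ∀ x y, T.Adj x y → t y = t x + 1 ∨ t x = t y + 1 ∨ (t x = 0 ∧ t y = 0)
  pred : ∀ n x, t x = n + 1 → ∃ y, T.Adj x y ∧ t y = n
  unique : ∀ x y z, T.Adj x y → T.Adj x z → t y ≤ t x → t z ≤ t x → y = z

variable {Γ : Subgroup (T ≃g T)} {ι : Type w} {G : SimpleGraph ι} {S : Set ι}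

/-- The projection from the oriented edges of `T` to those of `Γ \ T`. -/
def edgeProj (T : SimpleGraph V) (Γ : Subgroup (T ≃g T)) (d : T.Dart) :
    (quotientGraph T Γ).Edge :=
  Quotient.mk (edgeSetoid T Γ) d

/-- The labelling of the vertices of `T` given by an identification of the quotient graph. -/
def label (f : (quotientGraph T Γ).Iso (withLoops G S)) (x : V) : ι :=
  f.vert (quotientProj T Γ x)

variable (f : (quotientGraph T Γ).Iso (withLoops G S))

theorem label_surjective : Function.Surjective (label f) :=
  f.vert.surjective.comp (quotientProj_surjective Γ)

theorem label_eq_iff {x y : V} : label f x = label f y ↔ vertSetoid T Γ x y :=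
  (f.vert.apply_eq_iff_eq).trans quotientProj_eq_iff

theorem src_edge_mk (d : T.Dart) :
    (withLoops G S).src (f.edge (edgeProj T Γ d)) = label f d.fst :=
  f.src_edge _

theorem src_rev_edge_mk (d : T.Dart) :
    (withLoops G S).src ((withLoops G S).rev (f.edge (edgeProj T Γ d))) = label f d.snd := by
  rw [f.rev_edge]
  exact f.src_edge _

theorem edgeSetoid_iff_label {d e : T.Dart} :
    edgeSetoid T Γ d e ↔ label f d.fst = label f e.fst ∧ label f d.snd = label f e.snd := by
  constructor
  · rintro ⟨γ, hγ, h1, h2⟩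
    exact ⟨(label_eq_iff f).2 ⟨γ, hγ, h1⟩, (label_eq_iff f).2 ⟨γ, hγ, h2⟩⟩
  · rintro ⟨h1, h2⟩
    have h : edgeProj T Γ d = edgeProj T Γ e := by
      refine f.edge.injective (withLoops_edge_ext ?_ ?_)
      · rw [src_edge_mk, src_edge_mk, h1]
      · rw [src_rev_edge_mk, src_rev_edge_mk, h2]
    exact Quotient.exact h

theorem exists_adj_label {x : V} (e : (withLoops G S).Edge)
    (he : (withLoops G S).src e = label f x) :
    ∃ y, T.Adj x y ∧ label f y = (withLoops G S).src ((withLoops G S).rev e) := by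
  obtain ⟨q, rfl⟩ := f.edge.surjective e
  obtain ⟨d, rfl⟩ : ∃ d, edgeProj T Γ d = q := Quotient.exists_rep q
  rw [src_edge_mk] at he
  obtain ⟨γ, hγ, hx⟩ := (label_eq_iff f).1 he
  refine ⟨γ d.snd, ?_, ?_⟩
  · rw [← hx]
    exact γ.map_adj_iff.2 d.adj
  · rw [src_rev_edge_mk]
    exact ((label_eq_iff f).2 ⟨γ, hγ, rfl⟩).symm

theorem exists_adj_label_of_adj {x : V} {j : ι} (h : G.Adj (label f x) j) :
    ∃ y, T.Adj x y ∧ label f y = j :=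
  exists_adj_label f (Sum.inl ⟨(label f x, j), h⟩) rfl

theorem exists_adj_label_of_mem {x : V} (h : label f x ∈ S) :
    ∃ y, T.Adj x y ∧ label f y = label f x :=
  exists_adj_label f (Sum.inr ⟨label f x, h⟩) rfl

theorem adj_label {x y : V} (h : T.Adj x y) :
    G.Adj (label f x) (label f y) ∨ (label f x = label f y ∧ label f x ∈ S) := by
  have h1 := src_edge_mk f ⟨(x, y), h⟩
  have h2 := src_rev_edge_mk f ⟨(x, y), h⟩
  rcases he : f.edge (edgeProj T Γ ⟨(x, y), h⟩) with g | s
  · rw [he] at h1 h2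
    left
    have h3 : g.fst = label f x := h1
    have h4 : g.snd = label f y := h2
    rw [← h3, ← h4]
    exact g.adj
  · rw [he] at h1 h2
    right
    have h3 : s.1 = label f x := h1
    have h4 : s.1 = label f y := h2
    exact ⟨h3.symm.trans h4, h3 ▸ s.2⟩

/-- The index of an edge counts the neighbours of a vertex with a given label. -/
theorem index_mk (d : T.Dart) : (quotientGraph T Γ).index (edgeProj T Γ d) =
    Nat.card {y // T.Adj d.fst y ∧ label f y = label f d.snd} := by
  refine Nat.card_congr
    ⟨fun e => ⟨e.1.snd, ?_, ?_⟩, fun y => ⟨⟨(d.fst, y.1), y.2.1⟩, rfl, ?_⟩, ?_, ?_⟩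
  · have := e.1.adj
    rwa [e.2.1] at this
  · exact ((edgeSetoid_iff_label f).1 e.2.2).2.symm
  · exact (edgeSetoid_iff_label f).2 ⟨rfl, y.2.2.symm⟩
  · rintro ⟨e, he, he'⟩
    exact Subtype.ext (SimpleGraph.Dart.ext _ _ (Prod.ext he.symm rfl))
  · intro y
    rfl

theorem card_adj_eq_one {x y : V} {p : V → Prop} (hy : T.Adj x y) (hp : p y)
    (h : ∀ z, T.Adj x z → p z → z = y) : Nat.card {z // T.Adj x z ∧ p z} = 1 := by
  rw [Nat.card_eq_one_iff_unique]
  exact ⟨⟨fun a b => Subtype.ext ((h a a.2.1 a.2.2).trans (h b b.2.1 b.2.2).symm)⟩, ⟨y, hy, hp⟩⟩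

theorem eq_of_card_adj_eq_one {x y z : V} {p : V → Prop} (h : Nat.card {z // T.Adj x z ∧ p z} = 1)
    (hy : T.Adj x y) (hpy : p y) (hz : T.Adj x z) (hpz : p z) : y = z := by
  rw [Nat.card_eq_one_iff_unique] at h
  exact congrArg Subtype.val (h.1.elim (⟨y, hy, hpy⟩ : {z // T.Adj x z ∧ p z}) ⟨z, hz, hpz⟩)

/-- If the fibres of the labelling by the vertices of a ray are finite, then the labelling is
radial: in the finite forest of vertices with label at most `n`, some vertex, which can only be one
with label `n`, has at most one neighbour. -/
theorem isRadial_of_finite_fibers (hT : T.IsTree) (h2 : ∀ x y : V, ∃ z, T.Adj x z ∧ z ≠ y)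
    {S : Set ℕ} (f : (quotientGraph T Γ).Iso (withLoops (SimpleGraph.hasse ℕ) S))
    (hfin : ∀ n, {x | label f x = n}.Finite) : IsRadial T (label f) := by
  have hpred : ∀ n x, label f x = n + 1 → ∃ y, T.Adj x y ∧ label f y = n := fun n x hx =>
    exists_adj_label_of_adj f (hasse_nat_adj.2 (Or.inr hx.symm))
  have hstep : ∀ x y, T.Adj x y → label f y ≤ label f x + 1 := fun x y hxy => by
    rcases adj_label f hxy with h | h
    · rw [hasse_nat_adj] at h; omega
    · omega
  have hunique : ∀ x y z, T.Adj x y → T.Adj x z → label f y ≤ label f x →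
      label f z ≤ label f x → y = z := by
    intro x y z hy hz hyx hzx
    have hW : {w | label f w ≤ label f x}.Finite :=
      ((Set.finite_Iic (label f x)).biUnion fun n _ => hfin n).subset fun w hw =>
        Set.mem_biUnion (show label f w ∈ Set.Iic _ from hw) rfl
    obtain ⟨w, hw, hwu⟩ := exists_adj_mem_subsingleton hT hW ⟨x, le_refl (label f x)⟩
    have hw' : label f w ≤ label f x := hw
    have hwx : label f w = label f x := by
      by_contra hne
      obtain ⟨a, ha, -⟩ := h2 w w
      obtain ⟨b, hb, hba⟩ := h2 w a
      have h3 := hstep w a ha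
      have h4 := hstep w b hb
      exact hba (hwu b (show label f b ≤ label f x by omega) a
        (show label f a ≤ label f x by omega) hb ha)
    obtain ⟨γ, hγ, hγx⟩ := (label_eq_iff f).1 hwx.symm
    have hl : ∀ v, label f (γ v) = label f v := fun v =>
      ((label_eq_iff f).2 ⟨γ, hγ, rfl⟩).symm
    refine γ.injective (hwu _ ?_ _ ?_ ?_ ?_)
    · show label f (γ y) ≤ label f x
      rwa [hl]
    · show label f (γ z) ≤ label f x
      rwa [hl]
    · rw [← hγx]; exact γ.map_adj_iff.2 hy
    · rw [← hγx]; exact γ.map_adj_iff.2 hz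
  refine ⟨fun x y hxy => ?_, hpred, hunique⟩
  rcases adj_label f hxy with h | ⟨h, -⟩
  · rw [hasse_nat_adj] at h; omega
  · rcases hx : label f x with _ | n
    · omega
    · obtain ⟨z, hz, hzn⟩ := hpred n x hx
      have := hunique x y z hxy hz (by omega) (by omega)
      subst this
      omega

theorem isRadial_of_index {S : Set ℕ}
    (f : (quotientGraph T Γ).Iso (withLoops (SimpleGraph.hasse ℕ) S)) (hS : ∀ s ∈ S, s = 0)
    (hf : ∀ d : T.Dart, label f d.snd ≤ label f d.fst →
      (quotientGraph T Γ).index (edgeProj T Γ d) = 1) : IsRadial T (label f) := by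
  have hadj : ∀ x y, T.Adj x y → label f y = label f x + 1 ∨ label f x = label f y + 1 ∨
      (label f x = 0 ∧ label f y = 0) := by
    intro x y hxy
    rcases adj_label f hxy with h | ⟨h, hs⟩
    · rw [hasse_nat_adj] at h; omega
    · have := hS _ hs; omega
  refine ⟨hadj, fun n x hx => exists_adj_label_of_adj f (hasse_nat_adj.2 (Or.inr hx.symm)), ?_⟩
  intro x y z hy hz hyx hzx
  have h1 := hf ⟨(x, y), hy⟩ hyx
  rw [index_mk f] at h1
  refine eq_of_card_adj_eq_one h1 hy rfl hz ?_
  have h2 := hadj x y hy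
  have h3 := hadj x z hz
  change label f z = label f y
  omega

theorem exists_isRadial_of_isomorphic {k : ℕ}
    (h : (quotientGraph T Γ).Isomorphic (halfEdgeRay k) ∨
      (quotientGraph T Γ).Isomorphic (plainRay k)) :
    ∃ (S : Set ℕ) (f : (quotientGraph T Γ).Iso (withLoops (SimpleGraph.hasse ℕ) S)),
      IsRadial T (label f) := by
  have key₁ : ∀ f : (quotientGraph T Γ).Iso (withLoops (SimpleGraph.hasse ℕ) {0}),
      (∀ e, (halfEdgeRay k).index (f.edge e) = (quotientGraph T Γ).index e) →
      IsRadial T (label f) := by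
    intro f hf
    refine isRadial_of_index f (fun s hs => hs) fun d hd => ?_
    have h1 := src_edge_mk f d
    have h2 := src_rev_edge_mk f d
    rw [← hf]
    generalize f.edge (edgeProj T Γ d) = e at h1 h2 ⊢
    rcases e with g | s
    · have h3 : g.fst = label f d.fst := h1
      have h4 : g.snd = label f d.snd := h2
      change (if g.fst < g.snd then k - 1 else 1) = 1
      rw [h3, h4, if_neg (not_lt.2 hd)]
    · rfl
  have key₂ : ∀ f : (quotientGraph T Γ).Iso (withLoops (SimpleGraph.hasse ℕ) ∅),
      (∀ e, (plainRay k).index (f.edge e) = (quotientGraph T Γ).index e) →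
      IsRadial T (label f) := by
    intro f hf
    refine isRadial_of_index f (fun s hs => absurd hs (Set.notMem_empty s)) fun d hd => ?_
    have h1 := src_edge_mk f d
    have h2 := src_rev_edge_mk f d
    rw [← hf]
    generalize f.edge (edgeProj T Γ d) = e at h1 h2 ⊢
    rcases e with g | s
    · have h3 : g.fst = label f d.fst := h1
      have h4 : g.snd = label f d.snd := h2
      change (if g.fst < g.snd then (if g.fst = 0 then k else k - 1) else 1) = 1
      rw [h3, h4, if_neg (not_lt.2 hd)]
    · rfl
  rcases h with ⟨f, hf⟩ | ⟨f, hf⟩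
  · exact ⟨{0}, f, key₁ f hf⟩
  · exact ⟨∅, f, key₂ f hf⟩

variable [T.LocallyFinite] {k : ℕ}

theorem card_adj_eq_degree (hk : T.IsRegularOfDegree k) {x : V} {p : V → Prop}
    (h : ∀ z, T.Adj x z → p z) : Nat.card {z // T.Adj x z ∧ p z} = k := by
  rw [← hk x, ← T.card_neighborFinset_eq_degree, ← Nat.card_eq_finsetCard]
  refine Nat.card_congr (Equiv.subtypeEquivRight fun z =>
    (?_ : T.Adj x z ∧ p z ↔ z ∈ T.neighborFinset x))
  rw [T.mem_neighborFinset]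
  exact ⟨fun hz => hz.1, fun hz => ⟨hz, h z hz⟩⟩

theorem card_adj_eq_degree_sub_one (hk : T.IsRegularOfDegree k) {x y : V} {p : V → Prop}
    (hy : T.Adj x y) (h : ∀ z, T.Adj x z → (p z ↔ z ≠ y)) :
    Nat.card {z // T.Adj x z ∧ p z} = k - 1 := by
  classical
  rw [← hk x, ← T.card_neighborFinset_eq_degree,
    ← Finset.card_erase_of_mem ((T.mem_neighborFinset x y).2 hy), ← Nat.card_eq_finsetCard]
  refine Nat.card_congr (Equiv.subtypeEquivRight fun z => ?_)
  rw [Finset.mem_erase, T.mem_neighborFinset]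
  exact ⟨fun hz => ⟨(h z hz.1).1 hz.2, hz.1⟩, fun hz => ⟨hz.2, (h z hz.2).2 hz.1⟩⟩

/-- The two indexed rays differ in whether a vertex labelled `0` has a neighbour labelled `0`. -/
theorem isomorphic_of_isRadial (hk : T.IsRegularOfDegree k) {S : Set ℕ}
    (f : (quotientGraph T Γ).Iso (withLoops (SimpleGraph.hasse ℕ) S)) (hf : IsRadial T (label f)) :
    (quotientGraph T Γ).Isomorphic (halfEdgeRay k) ∨
      (quotientGraph T Γ).Isomorphic (plainRay k) := by
  have hS : ∀ s ∈ S, s = 0 := by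
    intro s hs
    obtain ⟨x, rfl⟩ := label_surjective f s
    obtain ⟨y, hy, hyx⟩ := exists_adj_label_of_mem f hs
    have := hf.adj x y hy
    omega
  have hdown : ∀ x y, T.Adj x y → label f y ≤ label f x →
      Nat.card {z // T.Adj x z ∧ label f z = label f y} = 1 := fun x y hy hyx =>
    card_adj_eq_one hy rfl fun z hz hzy => hf.unique x z y hz hy (by omega) hyx
  have hup : ∀ x y w, T.Adj x y → label f y = label f x + 1 → T.Adj x w →
      label f w ≤ label f x → Nat.card {z // T.Adj x z ∧ label f z = label f y} = k - 1 := by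
    intro x y w hy hyx hw hwx
    refine card_adj_eq_degree_sub_one hk hw fun z hz => ⟨fun h h' => ?_, fun h => ?_⟩
    · subst h'; omega
    · have h1 : ¬ label f z ≤ label f x := fun hc => h (hf.unique x z w hz hw hc hwx)
      have := hf.adj x z hz
      omega
  have hup' : ∀ x y, T.Adj x y → label f x ≠ 0 → label f y = label f x + 1 →
      Nat.card {z // T.Adj x z ∧ label f z = label f y} = k - 1 := by
    intro x y hy hx hyx
    obtain ⟨w, hw, hwx⟩ := hf.pred (label f x - 1) x (by omega)
    exact hup x y w hy hyx hw (by omega)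
  by_cases h0 : (0 : ℕ) ∈ S
  · obtain rfl : S = {0} := Set.eq_singleton_iff_unique_mem.2 ⟨h0, hS⟩
    refine Or.inl ⟨f, ?_⟩
    rintro ⟨d⟩
    have h1 := src_edge_mk f d
    have h2 := src_rev_edge_mk f d
    refine Eq.trans ?_ (index_mk f d).symm
    change (halfEdgeRay k).index (f.edge (edgeProj T Γ d)) = _
    generalize f.edge (edgeProj T Γ d) = e at h1 h2 ⊢
    rcases e with g | s
    · have h3 : g.fst = label f d.fst := h1
      have h4 : g.snd = label f d.snd := h2
      change (if g.fst < g.snd then k - 1 else 1) = _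
      rw [h3, h4]
      split_ifs with hlt
      · have hy : label f d.snd = label f d.fst + 1 := by
          have := hf.adj _ _ d.adj; omega
        by_cases hx : label f d.fst = 0
        · obtain ⟨w, hw, hwx⟩ := exists_adj_label_of_mem f (x := d.fst) (by rw [hx]; exact h0)
          exact (hup _ _ w d.adj hy hw hwx.le).symm
        · exact (hup' _ _ d.adj hx hy).symm
      · exact (hdown _ _ d.adj (by omega)).symm
    · have h3 : s.1 = label f d.fst := h1
      have h4 : s.1 = label f d.snd := h2
      change 1 = _
      exact (hdown _ _ d.adj (by omega)).symm
  · obtain rfl : S = ∅ := Set.eq_empty_iff_forall_notMem.2 fun s hs => h0 (hS s hs ▸ hs)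
    refine Or.inr ⟨f, ?_⟩
    rintro ⟨d⟩
    have h1 := src_edge_mk f d
    have h2 := src_rev_edge_mk f d
    refine Eq.trans ?_ (index_mk f d).symm
    change (plainRay k).index (f.edge (edgeProj T Γ d)) = _
    generalize f.edge (edgeProj T Γ d) = e at h1 h2 ⊢
    rcases e with g | s
    · have h3 : g.fst = label f d.fst := h1
      have h4 : g.snd = label f d.snd := h2
      change (if g.fst < g.snd then (if g.fst = 0 then k else k - 1) else 1) = _
      rw [h3, h4]
      have h5 := hf.adj _ _ d.adj
      split_ifs with hlt hx
      · refine (card_adj_eq_degree hk fun z hz => ?_).symm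
        rcases adj_label f hz with h | ⟨-, h⟩
        · rw [hasse_nat_adj] at h; omega
        · exact absurd h (Set.notMem_empty _)
      · exact (hup' _ _ d.adj hx (by omega)).symm
      · exact (hdown _ _ d.adj (by omega)).symm
    · exact absurd s.2 (Set.notMem_empty _)

theorem isomorphic_of_isEventuallyPeriodic {A : Type v} {φ : V → A} (hT : T.IsTree)
    (hk : T.IsRegularOfDegree k) (hφ : IsSturmian T φ) (h : IsEventuallyPeriodic T φ) :
    (quotientGraph T (colorAut T φ)).Isomorphic (halfEdgeRay k) ∨
      (quotientGraph T (colorAut T φ)).Isomorphic (plainRay k) := by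
  have hE := hφ.isSturmianRefinement hT hk
  obtain ⟨n, x, hx⟩ := exists_finite_cell hT.connected hφ h
  obtain ⟨S, ⟨f⟩⟩ := isRayWithLoops_of_hasFewTypes hT hk hφ ⟨n, x, hx.image _⟩
  refine isomorphic_of_isRadial hk f (isRadial_of_finite_fibers hT
    (exists_adj_ne hk (two_le_degree_of_isSturmian hT hk hφ)) f fun m => ?_)
  obtain ⟨y, rfl⟩ := label_surjective f m
  refine (finite_limit_class hT.connected hE hx y).subset fun z hz => ?_
  have h1 := (label_eq_iff f).1 (Eq.symm hz)
  rwa [vertSetoid_colorAut hT hk hφ] at h1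

end Radial

/-! ### Eventually periodic sequences -/

section Sequences

variable {α : Type u} {β : Type v}

theorem exists_eventual_period {s : ℕ → β} (hfin : (Set.range s).Finite) {N : ℕ}
    (h : ∀ i j, N ≤ i → N ≤ j → s i = s j → s (i + 1) = s (j + 1)) :
    ∃ p, 0 < p ∧ ∃ r, ∀ i, r ≤ i → s (i + p) = s i := by
  have := hfin.to_subtype
  obtain ⟨i, j, hij, he⟩ := Finite.exists_ne_map_eq_of_infinite
    (fun i : ℕ => (⟨s (N + i), Set.mem_range_self _⟩ : Set.range s))
  have he' : s (N + i) = s (N + j) := congrArg Subtype.val he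
  have key : ∀ i j, i < j → s (N + i) = s (N + j) →
      ∃ p, 0 < p ∧ ∃ r, ∀ i, r ≤ i → s (i + p) = s i := by
    intro i j hij he
    refine ⟨j - i, by omega, N + i, fun m hm => ?_⟩
    induction m, hm using Nat.le_induction with
    | base => rw [show N + i + (j - i) = N + j by omega, he]
    | succ m hm ih =>
      have := h _ _ (by omega) (by omega) ih
      rwa [show m + 1 + (j - i) = m + (j - i) + 1 by omega]
  rcases lt_or_gt_of_ne hij with h1 | h1
  · exact key i j h1 he'
  · exact key j i h1 he'.symm

/-- A sequence with at most three factors of length three is eventually periodic: if neither the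
preceding two letters nor the preceding letter determine the next one, then the three factors
have the same first letter. -/
theorem exists_eventual_period_of_card_le_three [Finite β] (hβ : Nat.card β ≤ 3) {s : ℕ → β}
    {c : ℕ → α} (h : ∀ i j, s i = s j → c i = c j ∧ c (i + 1) = c (j + 1) ∧ c (i + 2) = c (j + 2)) :
    ∃ p, 0 < p ∧ ∃ r, ∀ i, r ≤ i → c (i + p) = c i := by
  obtain ⟨g, hg⟩ : ∃ g : β → α × α, ∀ i, (c i, c (i + 1)) = g (s i) := by
    have : ∀ b : β, ∃ a : α × α, ∀ i, s i = b → (c i, c (i + 1)) = a := by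
      intro b
      by_cases hb : ∃ i, s i = b
      · obtain ⟨i, rfl⟩ := hb
        exact ⟨(c i, c (i + 1)), fun j hj => Prod.ext (h j i hj).1 (h j i hj).2.1⟩
      · exact ⟨(c 0, c 0), fun i hi => absurd ⟨i, hi⟩ hb⟩
    choose g hg using this
    exact ⟨g, fun i => hg _ i rfl⟩
  have hfin : (Set.range fun i => (c i, c (i + 1))).Finite :=
    (Set.finite_range g).subset (by rintro _ ⟨i, rfl⟩; exact ⟨s i, (hg i).symm⟩)
  by_cases hpair : ∀ i j, c i = c j → c (i + 1) = c (j + 1) → c (i + 2) = c (j + 2)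
  · obtain ⟨p, hp, r, hr⟩ := exists_eventual_period hfin (N := 0)
      fun i j _ _ hij => Prod.ext (Prod.ext_iff.1 hij).2
        (hpair i j (Prod.ext_iff.1 hij).1 (Prod.ext_iff.1 hij).2)
    exact ⟨p, hp, r, fun i hi => (Prod.ext_iff.1 (hr i hi)).1⟩
  by_cases hletter : ∀ i j, c i = c j → c (i + 1) = c (j + 1)
  · obtain ⟨p, hp, r, hr⟩ := exists_eventual_period hfin (N := 0)
      fun i j _ _ hij => Prod.ext (Prod.ext_iff.1 hij).2
        (hletter _ _ (Prod.ext_iff.1 hij).2)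
    exact ⟨p, hp, r, fun i hi => (Prod.ext_iff.1 (hr i hi)).1⟩
  push Not at hpair hletter
  obtain ⟨i, j, h1, h2, h3⟩ := hpair
  obtain ⟨m, l, h4, h5⟩ := hletter
  have hij : s i ≠ s j := fun hc => h3 (h i j hc).2.2
  -- one of `m`, `l` provides a third factor besides those at `i` and `j`
  have key : ∀ m, s i ≠ s m → s j ≠ s m → ∀ n, s n = s i ∨ s n = s j ∨ s n = s m := by
    intro m hi hj n
    by_contra! hc
    have hinj : Function.Injective ![s i, s j, s m, s n] := by
      intro a b hab
      fin_cases a <;> fin_cases b <;> simp_all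
    have := Nat.card_le_card_of_injective _ hinj
    rw [Nat.card_eq_fintype_card, Fintype.card_fin] at this
    omega
  have hconst : ∀ m, s i ≠ s m → s j ≠ s m → c m = c i → ∀ n, c n = c i := by
    intro m hi hj hm n
    rcases key m hi hj n with hn | hn | hn
    · exact (h n i hn).1
    · exact (h n j hn).1.trans h1.symm
    · exact (h n m hn).1.trans hm
  have hfirst : ∀ m l, c m = c l → c (m + 1) ≠ c (l + 1) → s i ≠ s m → s j ≠ s m →
      ∀ n, c n = c i := by
    intro m l h4 h5 hi hj
    refine hconst m hi hj ?_
    rcases key m hi hj l with hl | hl | hl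
    · exact h4.trans (h l i hl).1
    · exact (h4.trans (h l j hl).1).trans h1.symm
    · exact absurd (h l m hl).2.1.symm h5
  have hall : ∀ n, c n = c i := by
    by_cases hm : s i ≠ s m ∧ s j ≠ s m
    · exact hfirst m l h4 h5 hm.1 hm.2
    · have hm1 : c (m + 1) = c (i + 1) := by
        by_cases hi : s i = s m
        · exact (h i m hi).2.1.symm
        · have hj : s j = s m := by
            by_contra hj
            exact hm ⟨hi, hj⟩
          exact (h j m hj).2.1.symm.trans h2.symm
      refine hfirst l m h4.symm h5.symm (fun hi => ?_) (fun hj => ?_)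
      · exact h5 (hm1.trans (h i l hi).2.1)
      · exact h5 ((hm1.trans h2).trans (h j l hj).2.1)
  exact ⟨1, one_pos, 0, fun n _ => by rw [hall, hall n]⟩

theorem apply_add_mod_of_period {c : ℕ → α} {p r : ℕ} (hc : ∀ i, r ≤ i → c (i + p) = c i) (j : ℕ) :
    c (r + j % p) = c (r + j) := by
  have key : ∀ m i, r ≤ i → c (i + p * m) = c i := by
    intro m
    induction m with
    | zero => intro i _; simp
    | succ m ih =>
      intro i hi
      rw [Nat.mul_succ, ← Nat.add_assoc, hc _ (by omega), ih i hi]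
  conv_rhs => rw [← Nat.mod_add_div j p, ← Nat.add_assoc]
  exact (key _ _ (by omega)).symm

end Sequences

/-! ### Periodic colorings from height functions -/

section Height

variable {V : Type u} {A : Type v} {T : SimpleGraph V}

/-- Every edge of a graph without end vertices is the start of an infinite path without
backtracking. -/
theorem exists_ray (h2 : ∀ x y : V, ∃ z, T.Adj x z ∧ z ≠ y) {a b : V} (hab : T.Adj a b) :
    ∃ ρ : ℕ → V, ρ 0 = a ∧ ρ 1 = b ∧ (∀ n, T.Adj (ρ n) (ρ (n + 1))) ∧
      ∀ n, ρ (n + 2) ≠ ρ n := by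
  choose g hg1 hg2 using h2
  let s : ℕ → V × V := fun n => Nat.rec (a, b) (fun _ q => (q.2, g q.2 q.1)) n
  have hs : ∀ n, s (n + 1) = ((s n).2, g (s n).2 (s n).1) := fun n => rfl
  have hadj : ∀ n, T.Adj (s n).1 (s n).2 := by
    intro n
    cases n with
    | zero => exact hab
    | succ n => rw [hs]; exact hg1 _ _
  refine ⟨fun n => (s n).1, rfl, rfl, fun n => ?_, fun n => ?_⟩
  · simp only [hs]
    exact hadj n
  · simp only [hs]
    exact hg2 _ _

theorem dist_ray_add (hT : T.IsTree) {ρ : ℕ → V} (hρ : ∀ n, T.Adj (ρ n) (ρ (n + 1)))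
    (hρ' : ∀ n, ρ (n + 2) ≠ ρ n) {x : V} {N : ℕ}
    (hN : T.dist x (ρ (N + 1)) = T.dist x (ρ N) + 1) (m : ℕ) :
    T.dist x (ρ (N + m)) = T.dist x (ρ N) + m := by
  have key : ∀ m, T.dist x (ρ (N + m + 1)) = T.dist x (ρ (N + m)) + 1 := by
    intro m
    induction m with
    | zero => exact hN
    | succ m ih =>
      exact dist_eq_add_one_of_ne hT (hρ (N + m)).symm (hρ (N + m + 1)) ih (hρ' (N + m))
  induction m with
  | zero => rfl
  | succ m ih =>
    rw [← Nat.add_assoc, key, ih]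
    ring

/-- A height on a tree: every vertex has exactly one neighbour of height one less, and all
others have height one more. -/
structure IsHeight (T : SimpleGraph V) (h : V → ℤ) : Prop where
  adj : ∀ x y, T.Adj x y → h y = h x + 1 ∨ h y = h x - 1
  exists_lower : ∀ x, ∃ y, T.Adj x y ∧ h y = h x - 1
  unique_lower : ∀ x y z, T.Adj x y → T.Adj x z → h y = h x - 1 → h z = h x - 1 → y = z

/-- The Busemann function of a ray in a tree is a height. -/
theorem exists_isHeight_of_ray [T.LocallyFinite] (hT : T.IsTree) {ρ : ℕ → V}
    (hρ : ∀ n, T.Adj (ρ n) (ρ (n + 1))) (hρ' : ∀ n, ρ (n + 2) ≠ ρ n) :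
    ∃ h : V → ℤ, IsHeight T h ∧
      ∀ x, T.dist x (ρ 1) = T.dist x (ρ 0) + 1 → h x = T.dist x (ρ 0) := by
  have hex : ∀ x, ∃ N, T.dist x (ρ (N + 1)) = T.dist x (ρ N) + 1 := by
    intro x
    by_contra! hc
    have : ∀ n, T.dist x (ρ n) + n = T.dist x (ρ 0) := by
      intro n
      induction n with
      | zero => rfl
      | succ n ih =>
        have := hT.dist_eq_dist_add_one_of_adj x (hρ n)
        have := hc n
        omega
    have := this (T.dist x (ρ 0) + 1)
    omega
  choose N hN using hex
  set h : V → ℤ := fun x => T.dist x (ρ (N x)) - N x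
  have hlarge : ∀ x n, N x ≤ n → (T.dist (ρ n) x : ℤ) = h x + n := by
    intro x n hn
    have := dist_ray_add hT hρ hρ' (hN x) (n - N x)
    rw [show N x + (n - N x) = n by omega] at this
    rw [T.dist_comm]
    simp only [h]
    omega
  refine ⟨h, ⟨fun x y hxy => ?_, fun x => ?_, fun x y z hy hz hyx hzx => ?_⟩, fun x hx => ?_⟩
  · have h1 := hlarge x (max (N x) (N y)) (le_max_left _ _)
    have h2 := hlarge y (max (N x) (N y)) (le_max_right _ _)
    have := hT.dist_eq_dist_add_one_of_adj (ρ (max (N x) (N y))) hxy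
    omega
  · obtain ⟨M, hM⟩ := ((T.neighborSet x).toFinite.image N).bddAbove
    set n := max (N x) M + (h x).natAbs + 1
    have h1 := hlarge x n (by omega)
    have hne : x ≠ ρ n := by
      rintro he
      rw [← he, T.dist_self] at h1
      omega
    obtain ⟨y, hy, hd⟩ := exists_adj_dist_eq_add_one hT.connected hne
    have hMy : N y ≤ M := hM (Set.mem_image_of_mem N hy)
    have h2 := hlarge y n (by omega)
    exact ⟨y, hy, by omega⟩
  · have h1 := hlarge x (max (N x) (max (N y) (N z))) (by omega)
    have h2 := hlarge y (max (N x) (max (N y) (N z))) (by omega)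
    have h3 := hlarge z (max (N x) (max (N y) (N z))) (by omega)
    exact eq_of_adj_of_dist hT (r := ρ (max (N x) (max (N y) (N z)))) hy hz (by omega) (by omega)
  · have h1 := dist_ray_add hT hρ hρ' (N := 0) hx (N x)
    rw [Nat.zero_add] at h1
    simp only [h, h1]
    push_cast
    ring

/-- A coloring that depends only on a height modulo `p` is periodic. -/
theorem IsHeight.isPeriodic [T.LocallyFinite] {k : ℕ} (hT : T.IsTree)
    (hk : T.IsRegularOfDegree k) {h : V → ℤ} (hh : IsHeight T h) {p : ℕ} [NeZero p]
    (g : ZMod p → A) : IsPeriodic T fun x => g (h x) := by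
  classical
  let η : V → ZMod p := fun x => h x
  have hmatch : ∀ x y, Setoid.ker η x y → Matched T (Setoid.ker η) x y := by
    intro x y hxy
    have hxy' : η x = η y := hxy
    obtain ⟨a, ha, hax⟩ := hh.exists_lower x
    obtain ⟨b, hb, hby⟩ := hh.exists_lower y
    have hlow : ∀ {u v}, h v = h u - 1 → η v = η u - 1 := fun {u v} he => by
      simp only [η, he]; push_cast; ring
    have hupp : ∀ {u v}, h v = h u + 1 → η v = η u + 1 := fun {u v} he => by
      simp only [η, he]; push_cast; ring
    have hcard : Fintype.card (T.neighborSet x) = Fintype.card (T.neighborSet y) := by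
      rw [T.card_neighborSet_eq_degree, T.card_neighborSet_eq_degree, hk x, hk y]
    let σ := Fintype.equivOfCardEq hcard
    refine ⟨σ.trans (Equiv.swap (σ ⟨a, ha⟩) ⟨b, hb⟩), fun z => ?_⟩
    show η z = η _
    by_cases hz : z = ⟨a, ha⟩
    · subst hz
      rw [Equiv.trans_apply, Equiv.swap_apply_left, hlow hax, hlow hby, hxy']
    · have h1 : (σ.trans (Equiv.swap (σ ⟨a, ha⟩) ⟨b, hb⟩)) z ≠ ⟨b, hb⟩ := fun he => hz <| by
        apply (σ.trans (Equiv.swap (σ ⟨a, ha⟩) ⟨b, hb⟩)).injective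
        rw [he, Equiv.trans_apply, Equiv.swap_apply_left]
      generalize (σ.trans (Equiv.swap (σ ⟨a, ha⟩) ⟨b, hb⟩)) z = w at h1
      have h2 : h z = h x + 1 := by
        refine (hh.adj x z z.2).resolve_right fun hc => hz (Subtype.ext ?_)
        exact hh.unique_lower x z a z.2 ha hc hax
      have h3 : h w = h y + 1 := by
        refine (hh.adj y w w.2).resolve_right fun hc => h1 (Subtype.ext ?_)
        exact hh.unique_lower y w b w.2 hb hc hby
      rw [hupp h2, hupp h3, hxy']
  refine ⟨colorAut T η, ?_, ?_, fun γ hγ x => congrArg g (hγ x)⟩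
  · refine Finite.of_injective (β := ZMod p)
      (Quotient.lift η fun x y ⟨γ, hγ, hxy⟩ => by rw [← hxy, hγ x]) ?_
    rintro ⟨x⟩ ⟨y⟩ hxy
    obtain ⟨z, hz, -⟩ := hh.exists_lower x
    obtain ⟨γ, h1, h2⟩ := exists_iso_of_matched_vertex hT hmatch (show Setoid.ker η x y from hxy)
      ⟨z, hz⟩
    exact Quotient.sound ⟨γ, fun a => (show η a = η (γ a) from h2 a).symm, h1⟩
  · refine Finite.of_injective (β := ZMod p × ZMod p)
      (Quotient.lift (fun d : T.Dart => (η d.fst, η d.snd)) fun d e ⟨γ, hγ, h1, h2⟩ => by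
        rw [← h1, ← h2, hγ, hγ]) ?_
    rintro ⟨d⟩ ⟨e⟩ hde
    have h1 : η d.fst = η e.fst := congrArg Prod.fst hde
    have h2 : η d.snd = η e.snd := congrArg Prod.snd hde
    obtain ⟨γ, h3, h4, h5⟩ := exists_iso_of_matched hT hmatch d.adj e.adj h1 h2
    exact Quotient.sound ⟨γ, fun a => (show η a = η (γ a) from h5 a).symm, h3, h4⟩

end Height

/-! ### Radial colorings given by an eventually periodic sequence -/

section RadialColoring

variable {V : Type u} {A : Type v} {T : SimpleGraph V} {t : V → ℕ}

namespace IsRadial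

theorem le_add_dist (ht : IsRadial T t) (hT : T.Connected) (a x : V) :
    t x ≤ t a + T.dist a x := by
  induction hn : T.dist a x generalizing x with
  | zero =>
    obtain rfl := (hT.dist_eq_zero_iff).1 hn
    omega
  | succ n ih =>
    obtain ⟨y, hy, hd⟩ := exists_adj_dist_eq_add_one hT (r := a) (x := x)
      (by rintro rfl; simp at hn)
    have h1 := ih y (by omega)
    have h2 := ht.adj x y hy
    omega

/-- Away from a vertex `o` with label `0` labels increase, except possibly on one edge at `o`. -/
theorem eq_add_one_or (ht : IsRadial T t) (hT : T.IsTree) {o : V} (ho : t o = 0) {x y : V}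
    (hxy : T.Adj x y) (hd : T.dist o x = T.dist o y + 1) : t x = t y + 1 ∨ (y = o ∧ t x = 0) := by
  induction hn : T.dist o y generalizing x y with
  | zero =>
    obtain rfl := (hT.connected.dist_eq_zero_iff).1 hn
    rcases ht.adj x o hxy with h | h | h
    · omega
    · exact Or.inl h
    · exact Or.inr ⟨rfl, h.1⟩
  | succ n ih =>
    obtain ⟨z, hz, hdz⟩ := exists_adj_dist_eq_add_one hT.connected (r := o) (x := y)
      (by rintro rfl; simp at hn)
    left
    have h1 : t z ≤ t y := by
      rcases ih hz hdz (by omega) with h | ⟨h, -⟩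
      · omega
      · rw [h, ho]; omega
    have h2 : ¬ t x ≤ t y := fun hc => by
      have := ht.unique y x z hxy.symm hz hc h1
      subst this
      omega
    have := ht.adj x y hxy
    omega

theorem le_of_closer (ht : IsRadial T t) (hT : T.IsTree) {o : V} (ho : t o = 0) {x y : V}
    (hxy : T.Adj x y) (hd : T.dist o x = T.dist o y + 1) : t y ≤ t x := by
  rcases ht.eq_add_one_or hT ho hxy hd with h | ⟨h, -⟩
  · omega
  · rw [h, ho]; omega

theorem dist_le (ht : IsRadial T t) (hT : T.IsTree) {o : V} (ho : t o = 0) (x : V) :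
    T.dist o x ≤ t x + 1 := by
  induction hn : T.dist o x generalizing x with
  | zero => omega
  | succ n ih =>
    obtain ⟨y, hy, hd⟩ := exists_adj_dist_eq_add_one hT.connected (r := o) (x := x)
      (by rintro rfl; simp at hn)
    rcases ht.eq_add_one_or hT ho hy hd with h | ⟨h, -⟩
    · have := ih y (by omega)
      omega
    · rw [h, T.dist_self] at hd
      omega

theorem exists_eq_zero (ht : IsRadial T t) (hT : T.Connected) : ∃ o, t o = 0 := by
  obtain ⟨x⟩ := hT.nonempty
  induction hn : t x generalizing x with
  | zero => exact ⟨x, hn⟩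
  | succ n ih =>
    obtain ⟨y, -, hy⟩ := ht.pred n x hn
    exact ih y hy

theorem induce_connected (ht : IsRadial T t) (hT : T.IsTree) (r : ℕ) :
    (T.induce {x | t x ≤ r}).Connected := by
  obtain ⟨o, ho⟩ := ht.exists_eq_zero hT.connected
  have ho' : o ∈ {x | t x ≤ r} := show t o ≤ r by omega
  have h : ∀ n x (hx : x ∈ {x | t x ≤ r}), T.dist o x = n →
      (T.induce {x | t x ≤ r}).Reachable ⟨o, ho'⟩ ⟨x, hx⟩ := by
    intro n
    induction n with
    | zero =>
      intro x hx hn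
      obtain rfl := (hT.connected.dist_eq_zero_iff).1 hn
      exact SimpleGraph.Reachable.refl _
    | succ n ih =>
      intro x hx hn
      obtain ⟨y, hy, hd⟩ := exists_adj_dist_eq_add_one hT.connected (r := o) (x := x)
        (by rintro rfl; simp at hn)
      have hy' : y ∈ {x | t x ≤ r} := (ht.le_of_closer hT ho hy hd).trans hx
      have hadj : (T.induce {x | t x ≤ r}).Adj ⟨y, hy'⟩ ⟨x, hx⟩ := hy.symm
      exact (ih y hy' (by omega)).trans hadj.reachable
  have : Nonempty {x | t x ≤ r} := ⟨⟨o, ho'⟩⟩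
  exact ⟨fun x y => (h _ x x.2 rfl).symm.trans (h _ y y.2 rfl)⟩

theorem exists_apex (ht : IsRadial T t) (hT : T.Connected) {m : ℕ} (x : V) (hx : m ≤ t x) :
    ∃ a, t a = m ∧ t x = T.dist a x + m := by
  obtain ⟨n, hn⟩ : ∃ n, t x = m + n := ⟨t x - m, by omega⟩
  induction n generalizing x with
  | zero => exact ⟨x, by omega, by simp [hn]⟩
  | succ n ih =>
    obtain ⟨y, hy, hyn⟩ := ht.pred (m + n) x (by omega)
    obtain ⟨a, ha, hay⟩ := ih y (by omega) hyn
    have h1 := dist_le_add_one hT a hy.symm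
    have h2 := ht.le_add_dist hT a x
    exact ⟨a, ha, by omega⟩

/-- The cone of vertices above a vertex `a` can only be left through `a`. -/
theorem mem_cone_of_adj (ht : IsRadial T t) (hT : T.Connected) {m : ℕ} (hm : 0 < m) {a x y : V}
    (ha : t a = m) (hx : t x = T.dist a x + m) (hxy : T.Adj x y) (hy : m ≤ t y) :
    t y = T.dist a y + m := by
  have h1 := ht.le_add_dist hT a y
  have h2 := dist_le_add_one hT a hxy
  rcases ht.adj x y hxy with h | h | h
  · omega
  · have hxa : x ≠ a := by
      rintro rfl
      omega
    obtain ⟨z, hz, hd⟩ := exists_adj_dist_eq_add_one hT hxa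
    have h3 := ht.le_add_dist hT a z
    obtain rfl := ht.unique x y z hxy hz (by omega) (by omega)
    omega
  · omega

/-- A radial coloring whose sequence of colors is eventually periodic is eventually periodic: on
each cone it agrees with a periodic coloring, since there the label differs by a constant from the
Busemann function of a ray that leaves the cone through its apex. -/
theorem isEventuallyPeriodic [T.LocallyFinite] {k : ℕ} (ht : IsRadial T t) (hT : T.IsTree)
    (hk : T.IsRegularOfDegree k) (h2 : 2 ≤ k) {φ : V → A} {c : ℕ → A} (hc : ∀ x, φ x = c (t x))
    {p r : ℕ} (hp : 0 < p) (hr : ∀ i, r ≤ i → c (i + p) = c i) : IsEventuallyPeriodic T φ := by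
  have : NeZero p := ⟨hp.ne'⟩
  refine ⟨{x | t x ≤ r}, ?_, ht.induce_connected hT r, fun C => ?_⟩
  · obtain ⟨o, ho⟩ := ht.exists_eq_zero hT.connected
    refine (finite_ball hT.connected (r + 1) o).subset fun x hx => ?_
    exact (ht.dist_le hT ho x).trans (Nat.add_le_add_right hx 1)
  induction C using SimpleGraph.ConnectedComponent.ind with
  | _ x₀ =>
  have hout : ∀ x : ↥({x | t x ≤ r}ᶜ), r + 1 ≤ t x := fun x =>
    not_le.1 (show ¬ t x ≤ r from x.2)
  obtain ⟨a, ha, hax₀⟩ := ht.exists_apex hT.connected x₀ (hout x₀)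
  have hcone : ∀ x ∈ ((T.induce {x | t x ≤ r}ᶜ).connectedComponentMk x₀).supp,
      t x = T.dist a x + (r + 1) := by
    intro x hx
    obtain ⟨q⟩ := (SimpleGraph.ConnectedComponent.exact hx).symm
    induction q with
    | nil => exact hax₀
    | @cons u v w huv q ih =>
      refine ih (ht.mem_cone_of_adj hT.connected (Nat.succ_pos r) ha hax₀ huv (hout v)) ?_
      exact (SimpleGraph.ConnectedComponent.sound q.reachable).symm
  obtain ⟨b, hab, hb⟩ := ht.pred r a ha
  obtain ⟨ρ, hρ0, hρ1, hρ, hρ'⟩ := exists_ray (exists_adj_ne hk h2) hab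
  obtain ⟨h, hh, hdist⟩ := exists_isHeight_of_ray hT hρ hρ'
  refine ⟨_, hh.isPeriodic hT hk fun i : ZMod p => c (r + 1 + i.val), fun x hx => ?_⟩
  have h3 := hcone x hx
  have h4 : h x = T.dist a x := by
    have h5 := ht.le_add_dist hT.connected b x
    have h6 := dist_le_add_one hT.connected (x : V) hab
    rw [T.dist_comm (u := b)] at h5
    rw [T.dist_comm (u := a)] at h3
    rw [hdist x (by rw [hρ0, hρ1]; omega), hρ0, T.dist_comm]
  show c (r + 1 + ZMod.val ((h x : ℤ) : ZMod p)) = φ x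
  rw [h4, Int.cast_natCast, ZMod.val_natCast,
    apply_add_mod_of_period (fun i hi => hr i (by omega)), hc, h3, Nat.add_comm]

end IsRadial

end RadialColoring

/-! ### The sequence of colors of a radial Sturmian coloring -/

section SturmianRadial

variable {V : Type u} {A : Type v} {T : SimpleGraph V} {φ : V → A} {t : V → ℕ}

theorem IsRadial.eq_add_one_of_ne (ht : IsRadial T t) {x a b : V} (ha : T.Adj x a)
    (hax : t x = t a + 1) (hb : T.Adj x b) (hne : b ≠ a) : t b = t x + 1 := by
  have h1 : ¬ t b ≤ t x := fun hc => hne (ht.unique x b a hb ha hc (by omega))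
  have := ht.adj x b hb
  omega

variable [T.LocallyFinite] {k : ℕ}

theorem exists_adj_ne_ne (hk : T.IsRegularOfDegree k) (h3 : 3 ≤ k) (x a b : V) :
    ∃ z, T.Adj x z ∧ z ≠ a ∧ z ≠ b := by
  classical
  have h1 : ({a, b} : Finset V).card < (T.neighborFinset x).card := by
    rw [T.card_neighborFinset_eq_degree, hk x]
    exact (Finset.card_le_two).trans_lt (by omega)
  obtain ⟨z, hz, hne⟩ := Finset.exists_mem_notMem_of_card_lt_card h1
  simp only [Finset.mem_insert, Finset.mem_singleton, not_or] at hne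
  exact ⟨z, (T.mem_neighborFinset x z).1 hz, hne⟩

/-- If the degree is at least three, then the colors of the neighbours of a vertex, counted with
multiplicity, tell the color of the neighbour with smaller label from the color of those with
larger label, as there are several of the latter. -/
theorem IsRadial.color_eq_of_matched (ht : IsRadial T t) (hk : T.IsRegularOfDegree k) (h3 : 3 ≤ k)
    {c : ℕ → A} (hc : ∀ x, φ x = c (t x)) {x y : V} {i j : ℕ} (hx : t x = i + 1)
    (hy : t y = j + 1) (h : Matched T (Setoid.ker φ) x y) :
    c i = c j ∧ c (i + 2) = c (j + 2) := by
  obtain ⟨σ, hσ⟩ := h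
  have hσ' : ∀ z : T.neighborSet x, φ z = φ (σ z) := hσ
  obtain ⟨a, ha, hai⟩ := ht.pred i x hx
  obtain ⟨b, hb, hbj⟩ := ht.pred j y hy
  have hup : ∀ z : T.neighborSet x, z ≠ ⟨a, ha⟩ → φ z = c (i + 2) := fun z hz => by
    rw [hc, ht.eq_add_one_of_ne ha (by omega) z.2 fun he => hz (Subtype.ext he), hx]
  have hup' : ∀ z : T.neighborSet y, z ≠ ⟨b, hb⟩ → φ z = c (j + 2) := fun z hz => by
    rw [hc, ht.eq_add_one_of_ne hb (by omega) z.2 fun he => hz (Subtype.ext he), hy]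
  have h2 : c (i + 2) = c (j + 2) := by
    obtain ⟨z, hz, hza, hzb⟩ := exists_adj_ne_ne hk h3 x a (σ.symm ⟨b, hb⟩)
    rw [← hup ⟨z, hz⟩ fun he => hza (congrArg Subtype.val he), hσ']
    refine hup' _ fun he => hzb ?_
    rw [← he, Equiv.symm_apply_apply]
  refine ⟨?_, h2⟩
  have h4 : φ a = c i := by rw [hc, hai]
  have h5 : φ b = c j := by rw [hc, hbj]
  by_cases hab : σ ⟨a, ha⟩ = ⟨b, hb⟩
  · rw [← h4, ← h5]
    have := hσ' ⟨a, ha⟩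
    rwa [hab] at this
  · have h6 := hσ' (σ.symm ⟨b, hb⟩)
    rw [Equiv.apply_symm_apply, hup _ fun he => hab (by rw [← he, Equiv.apply_symm_apply])] at h6
    have h7 := hσ' ⟨a, ha⟩
    rw [hup' _ hab] at h7
    exact h4.symm.trans (h7.trans (h2.symm.trans (h6.trans h5)))

/-- For degree at least three the three colored `1`-balls give at most three factors of length
three in the sequence of colors. -/
theorem IsRadial.exists_eventual_period_of_three_le (ht : IsRadial T t)
    (hsurj : Function.Surjective t) (hT : T.IsTree) (hk : T.IsRegularOfDegree k) (h3 : 3 ≤ k)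
    (hφ : IsSturmian T φ) {c : ℕ → A} (hc : ∀ x, φ x = c (t x)) :
    ∃ p, 0 < p ∧ ∃ r, ∀ i, r ≤ i → c (i + p) = c i := by
  have hE := hφ.isSturmianRefinement hT hk
  choose x hx using hsurj
  have := hE.finite_quotient 1
  refine exists_eventual_period_of_card_le_three (hE.card 1).le
    (s := fun i => Quotient.mk (ballSetoid T φ 1) (x (i + 1))) fun i j hij => ?_
  have h1 : ballSetoid T φ 1 (x (i + 1)) (x (j + 1)) := Quotient.exact hij
  have hcol : ∀ {n a b}, ballSetoid T φ n a b → φ a = φ b := fun h =>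
    color_eq_of_ballSetoid hT hk (by omega) h
  obtain ⟨σ, hσ⟩ := hE.matched 0 _ _ h1
  obtain ⟨h4, h5⟩ := ht.color_eq_of_matched hk h3 hc (hx (i + 1)) (hx (j + 1))
    ⟨σ, fun z => hcol (hσ z)⟩
  refine ⟨h4, ?_, h5⟩
  have := hcol h1
  rwa [hc, hc, hx, hx] at this

/-- For bounded type the classes at some level of two consecutive vertices determine the class of
the next one. -/
theorem IsRadial.exists_eventual_period_of_hasFewTypes (ht : IsRadial T t)
    (hsurj : Function.Surjective t)
    (htl : ∀ x y, t x = t y ↔ limitSetoid (ballSetoid T φ) x y) (hT : T.IsTree)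
    (hk : T.IsRegularOfDegree k) (hφ : IsSturmian T φ)
    (h : ∃ n x, HasFewTypes (ballSetoid T φ) (cell (ballSetoid T φ) n x)) {c : ℕ → A}
    (hc : ∀ x, φ x = c (t x)) : ∃ p, 0 < p ∧ ∃ r, ∀ i, r ≤ i → c (i + p) = c i := by
  have hE := hφ.isSturmianRefinement hT hk
  have h2 := two_le_degree_of_isSturmian hT hk hφ
  obtain ⟨n, B, hB, hBn⟩ := hE.exists_rel_succ hT.connected h
  obtain ⟨N, hN⟩ : ∃ N, ∀ x ∈ B, t x ≤ N := by
    let l : Quotient (limitSetoid (ballSetoid T φ)) → ℕ :=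
      Quotient.lift t fun x y h => (htl x y).2 h
    obtain ⟨N, hN⟩ := (Set.Finite.image l hB).bddAbove
    exact ⟨N, fun x hx => hN ⟨_, ⟨x, hx, rfl⟩, rfl⟩⟩
  choose x hx using hsurj
  have := hE.finite_quotient n
  let q : V → Quotient (ballSetoid T φ n) := Quotient.mk _
  have hq : ∀ y i, t y = i → q y = q (x i) := fun y i hy =>
    Quotient.sound ((htl y (x i)).1 (by rw [hy, hx]) n)
  obtain ⟨p, hp, r, hr⟩ := exists_eventual_period (s := fun i => (q (x i), q (x (i + 1))))
    (Set.toFinite _) (N := N) fun i j hi hj hij => by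
      have h1 : q (x i) = q (x j) := congrArg Prod.fst hij
      have h3 : q (x (i + 1)) = q (x (j + 1)) := congrArg Prod.snd hij
      have hout : ∀ i, N ≤ i → x (i + 1) ∉ B := fun i hi hc => by
        have := hN _ hc
        rw [hx] at this
        omega
      obtain ⟨a, ha, hai⟩ := ht.pred i (x (i + 1)) (hx _)
      obtain ⟨b, hb, hbj⟩ := ht.pred j (x (j + 1)) (hx _)
      have hab : ballSetoid T φ n a b :=
        Quotient.exact ((hq a i hai).trans (h1.trans (hq b j hbj).symm))
      obtain ⟨σ, hσ, hσa⟩ := (hE.matched n _ _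
        (hBn _ _ (hout i hi) (hout j hj) (Quotient.exact h3))).exists_equiv ha hb hab
      obtain ⟨z, hz, hza⟩ := exists_adj_ne hk h2 (x (i + 1)) a
      have hσz : (σ ⟨z, hz⟩ : V) ≠ b := fun he => hza <| by
        have h4 : σ ⟨z, hz⟩ = σ ⟨a, ha⟩ := by rw [hσa]; exact Subtype.ext he
        exact congrArg Subtype.val (σ.injective h4)
      have h4 := ht.eq_add_one_of_ne ha (by rw [hx, hai]) hz hza
      have h5 := ht.eq_add_one_of_ne hb (by rw [hx, hbj]) (σ ⟨z, hz⟩).2 hσz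
      rw [hx] at h4 h5
      have h6 : q z = q (σ ⟨z, hz⟩) := Quotient.sound (hσ ⟨z, hz⟩)
      exact Prod.ext h3 ((hq z _ h4).symm.trans (h6.trans (hq _ _ h5)))
  refine ⟨p, hp, r, fun i hi => ?_⟩
  have h1 : q (x (i + p)) = q (x i) := congrArg Prod.fst (hr i hi)
  have h3 := color_eq_of_ballSetoid hT hk h2 (Quotient.exact h1)
  rwa [hc, hc, hx, hx] at h3

theorem isEventuallyPeriodic_of_isomorphic (hT : T.IsTree) (hk : T.IsRegularOfDegree k)
    (hφ : IsSturmian T φ) (h : 3 ≤ k ∨ IsBoundedType T φ)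
    (hX : (quotientGraph T (colorAut T φ)).Isomorphic (halfEdgeRay k) ∨
      (quotientGraph T (colorAut T φ)).Isomorphic (plainRay k)) : IsEventuallyPeriodic T φ := by
  obtain ⟨S, f, hf⟩ := exists_isRadial_of_isomorphic hX
  have hsurj := label_surjective f
  obtain ⟨x, hx⟩ := hsurj.hasRightInverse
  have hc : ∀ y, φ y = φ (x (label f y)) := fun y => by
    obtain ⟨γ, hγ, hγy⟩ := (label_eq_iff f).1 (hx (label f y)).symm
    rw [← hγy, hγ]
  have hper : ∃ p, 0 < p ∧ ∃ r, ∀ i, r ≤ i → φ (x (i + p)) = φ (x i) := by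
    rcases h with h | h
    · exact hf.exists_eventual_period_of_three_le hsurj hT hk h hφ (c := fun i => φ (x i)) hc
    · refine hf.exists_eventual_period_of_hasFewTypes hsurj (fun a b => ?_) hT hk hφ
        (exists_hasFewTypes_of_isBoundedType hT hk hφ h) (c := fun i => φ (x i)) hc
      rw [label_eq_iff, vertSetoid_colorAut hT hk hφ]
  obtain ⟨p, hp, r, hr⟩ := hper
  exact hf.isEventuallyPeriodic hT hk (two_le_degree_of_isSturmian hT hk hφ)
    (c := fun i => φ (x i)) hc hp hr

end SturmianRadial

end TreeColoring

theorem theoremA {V A : Type*} (T : SimpleGraph V) [T.LocallyFinite] (hT : T.IsTree)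
    (k : ℕ) (hk : T.IsRegularOfDegree k) (φ : V → A) (hφ : IsSturmian T φ) :
    -- the group of color-preserving automorphisms, its quotient graph, and `φ` as a lift
    (∀ γ ∈ colorAut T φ, ∀ x, φ (γ x) = φ x) ∧
    (∃ φX : (quotientGraph T (colorAut T φ)).Vert → A,
      ∀ x, φ x = φX (quotientProj T (colorAut T φ) x)) ∧
    ((quotientGraph T (colorAut T φ)).IsRayWithLoops ∨
      (quotientGraph T (colorAut T φ)).IsLineWithLoops) ∧
    -- colorings of bounded type
    (IsBoundedType T φ → (quotientGraph T (colorAut T φ)).IsRayWithLoops) ∧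
    -- eventually periodic colorings
    (IsEventuallyPeriodic T φ →
      (quotientGraph T (colorAut T φ)).Isomorphic (halfEdgeRay k) ∨
      (quotientGraph T (colorAut T φ)).Isomorphic (plainRay k)) ∧
    (3 ≤ k ∨ IsBoundedType T φ →
      (quotientGraph T (colorAut T φ)).Isomorphic (halfEdgeRay k) ∨
      (quotientGraph T (colorAut T φ)).Isomorphic (plainRay k) →
      IsEventuallyPeriodic T φ) := by
  refine ⟨fun γ hγ => hγ, ?_, isRayWithLoops_or_isLineWithLoops hT hk hφ, fun h => ?_,
    isomorphic_of_isEventuallyPeriodic hT hk hφ, isEventuallyPeriodic_of_isomorphic hT hk hφ⟩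
  · exact ⟨Quotient.lift φ fun x y ⟨γ, hγ, hxy⟩ => by rw [← hxy, hγ], fun x => rfl⟩
  · exact isRayWithLoops_of_hasFewTypes hT hk hφ (exists_hasFewTypes_of_isBoundedType hT hk hφ h)
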